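/- Let $M$ be a smooth (Hausdorff, second countable, finite-dimensional) manifold with a (real) Poisson structure $\{\cdot,\cdot\}$, and let $C^\infty(M)$ be the algebra of complex-valued smooth functions on $M$. A star product on $M$ is a $\mathbb C[[\lambda]]$-bilinear associative product $\star$ on $C^\infty(M)[[\lambda]]$ such that $f\star g=\sum_{r\ge 0}\lambda^r C_r(f,g)$ for $f,g\in C^\infty(M)$, where the $C_r$ are bidifferential operators, $C_0(f,g)=fg$ and $C_1(f,g)-C_1(g,f)=i\{f,g\}$. It is Hermitian if $\overline{f\star g}=\overline g\star\overline f$ (with $\overline\lambda=\lambda$); then $(C^\infty(M)[[\lambda]],\star)$ is a unital $^*$-algebra over $\mathbb C[[\lambda]]$ with involution complex conjugation. Order $\mathbb R[[\lambda]]$ by calling a nonzero series positive if its lowest nonvanishing coefficient is positive; for $z\in\mathbb C[[\lambda]]$, $z\ge 0$ ($z>0$) means that $z$ lies in $\mathbb R[[\lambda]]$ and is nonnegative (positive) there. A linear functional $\omega$ on a $^*$-algebra $\mathcal A$ over $\mathbb C[[\lambda]]$ is positive if $\omega(a^*a)\ge 0$ for all $a\in\mathcal A$, and $a\in\mathcal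 A$ is positive if $\omega(a)\ge0$ for all positive linear functionals $\omega$. A pre-Hilbert space over $\mathbb C[[\lambda]]$ is a $\mathbb C[[\lambda]]$-module $H$ with a sesquilinear map $\langle\cdot,\cdot\rangle:H\times H\to\mathbb C[[\lambda]]$, linear in the second argument, such that $\overline{\langle\psi,\phi\rangle}=\langle\phi,\psi\rangle$ and $\langle\phi,\phi\rangle>0$ for $\phi\ne0$. A $^*$-representation $(H,\pi)$ of $\mathcal A$ is a $^*$-homomorphism $\pi$ from $\mathcal A$ to the adjointable endomorphisms of a pre-Hilbert space $H$. Unital $^*$-algebras $\mathcal A,\mathcal B$ over $\mathbb C[[\lambda]]$ are strongly Morita equivalent if there is a $(\mathcal B,\mathcal A)$-bimodule $\mathcal E$ (with compatible $\mathbb C[[\lambda]]$-module structure) with a $\mathbb C[[\lambda]]$-sesquilinear map $\langle\cdot,\cdot\rangle:\mathcal E\times\mathcal E\to\mathcal A$, linear in the second argument, and a $\mathbb C[[\lambda]]$-sesquilinear map $\Theta:\mathcal E\times\mathcal E\to\mathcal B$, linear in the first argument, such that for all $x,y,z\in\mathcal E$, $a\in\mathcal A$, $b\in\mathcal B$: 1.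 $\langle x,y\rangle=\langle y,x\rangle^*$, $\langle x,y\cdot a\rangle=\langle x,y\rangle a$, $\langle b\cdot x,y\rangle=\langle x,b^*\cdot y\rangle$, and $\langle x,x\rangle$ is positive in $\mathcal A$; 2. $\Theta_{x,y}=\Theta_{y,x}^*$, $\Theta_{b\cdot x,y}=b\,\Theta_{x,y}$, $\Theta_{x,y\cdot a}=\Theta_{x\cdot a^*,y}$, and $\Theta_{x,x}$ is positive in $\mathcal B$; 3. $\Theta_{x,y}\cdot z=x\cdot\langle y,z\rangle$; 4. the elements $\langle x,y\rangle$ span $\mathcal A$ and the elements $\Theta_{x,y}$ span $\mathcal B$ over $\mathbb C[[\lambda]]$; 5. for every $^*$-representation $(H,\pi)$ of $\mathcal A$, the inner product $\langle x\otimes\phi,y\otimes\psi\rangle=\langle\phi,\pi(\langle x,y\rangle)\psi\rangle$ on $\mathcal E\otimes_{\mathcal A}H$ is positive semi-definite. **Theorem.** Let $\star$ and $\star'$ be Hermitian star products on the Poisson manifold $M$. Then $(C^\infty(M)[[\lambda]],\star)$ and $(C^\infty(M)[[\lambda]],\star')$ are strongly Morita equivalent as $^*$-algebras over $\mathbb C[[\lambda]]$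 if and only if they are Morita equivalent as unital $\mathbb C[[\lambda]]$-algebras, i.e. their categories of left modules are equivalent by a $\mathbb C[[\lambda]]$-linear equivalence. -/

import Mathlib

open scoped Manifold ContDiff PowerSeries
open MulOpposite (op)

universe u

/-! ## Complex-valued smooth functions -/

instance : ContMDiffRing 𝓘(ℝ, ℂ) ∞ ℂ :=
  { (inferInstance : LieAddGroup 𝓘(ℝ, ℂ) ∞ ℂ) with
    contMDiff_mul := by
      rw [contMDiff_iff]
      refine ⟨continuous_mul, fun x y => ?_⟩
      simp only [mfld_simps, chartAt_self_eq]
      rw [contDiffOn_univ]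
      exact contDiff_mul }

/-- The commutative algebra of smooth complex-valued functions on the `n`-dimensional
manifold `M`. -/
abbrev SmoothFun (n : ℕ) (M : Type u) [TopologicalSpace M]
    [ChartedSpace (EuclideanSpace ℝ (Fin n)) M] : Type u :=
  C^∞⟮𝓡 n, M; 𝓘(ℝ, ℂ), ℂ⟯

namespace SmoothFun

/-- Constant functions. -/
noncomputable def constHom (n : ℕ) (M : Type u) [TopologicalSpace M]
    [ChartedSpace (EuclideanSpace ℝ (Fin n)) M] : ℂ →+* SmoothFun n M where
  toFun c := ContMDiffMap.const c
  map_one' := rfl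
  map_mul' _ _ := rfl
  map_zero' := rfl
  map_add' _ _ := rfl

noncomputable instance instAlgebraComplex {n : ℕ} {M : Type u} [TopologicalSpace M]
    [ChartedSpace (EuclideanSpace ℝ (Fin n)) M] : Algebra ℂ (SmoothFun n M) :=
  (constHom n M).toAlgebra

/-- Pointwise complex conjugation. -/
noncomputable instance instStarRing {n : ℕ} {M : Type u} [TopologicalSpace M]
    [ChartedSpace (EuclideanSpace ℝ (Fin n)) M] : StarRing (SmoothFun n M) where
  star f := ⟨fun x => star (f x),
    (starL' ℝ (A := ℂ)).toContinuousLinearMap.contMDiff.comp f.contMDiff⟩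
  star_involutive f := by
    ext x
    exact star_star (f x)
  star_mul f g := by
    ext x
    exact star_mul (f x) (g x)
  star_add f g := by
    ext x
    exact star_add (f x) (g x)

theorem smul_apply {n : ℕ} {M : Type u} [TopologicalSpace M]
    [ChartedSpace (EuclideanSpace ℝ (Fin n)) M] (c : ℂ) (f : SmoothFun n M) (x : M) :
    (c • f) x = c * f x := rfl

theorem star_apply {n : ℕ} {M : Type u} [TopologicalSpace M]
    [ChartedSpace (EuclideanSpace ℝ (Fin n)) M] (f : SmoothFun n M) (x : M) :
    (star f) x = star (f x) := rfl

instance instStarModule {n : ℕ} {M : Type u} [TopologicalSpace M]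
    [ChartedSpace (EuclideanSpace ℝ (Fin n)) M] : StarModule ℂ (SmoothFun n M) where
  star_smul c f := by
    ext x
    simp [star_apply, smul_apply]

end SmoothFun

/-- A (real) Poisson structure on the manifold `M`, given by its Poisson bracket
`{f, g} = π₀(df, dg)` on complex-valued smooth functions: an alternating `ℂ`-bilinear biderivation
satisfying the Jacobi identity which is real, i.e. commutes with complex conjugation. -/
structure PoissonStructure (n : ℕ) (M : Type u) [TopologicalSpace M]
    [ChartedSpace (EuclideanSpace ℝ (Fin n)) M] where
  bracket : SmoothFun n M →ₗ[ℂ] SmoothFun n M →ₗ[ℂ] SmoothFun n M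
  bracket_self : ∀ f, bracket f f = 0
  leibniz : ∀ f g h, bracket f (g * h) = bracket f g * h + g * bracket f h
  jacobi : ∀ f g h,
    bracket f (bracket g h) + bracket g (bracket h f) + bracket h (bracket f g) = 0
  real : ∀ f g, star (bracket f g) = bracket (star f) (star g)

/-! ## Differential and bidifferential operators -/

/-- `D` is a linear differential operator of order at most `k` on the commutative algebra `A`:
its `(k+1)`-fold iterated commutators with multiplication operators vanish.  For the algebra of
smooth functions on a manifold these are the usual differential operators. -/
def IsDiffOp {A : Type u} [CommRing A] [Algebra ℂ A] : ℕ → (A →ₗ[ℂ] A) → Prop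
  | 0, D => ∀ a f, D (a * f) = a * D f
  | k + 1, D => ∀ a, IsDiffOp k (D ∘ₗ LinearMap.mulLeft ℂ a - LinearMap.mulLeft ℂ a ∘ₗ D)

/-- A bidifferential operator: a bilinear map that is a differential operator in each argument,
of bounded order. -/
def IsBidiffOp {A : Type u} [CommRing A] [Algebra ℂ A] (D : A →ₗ[ℂ] A →ₗ[ℂ] A) : Prop :=
  ∃ k : ℕ, (∀ g, IsDiffOp k (D.flip g)) ∧ ∀ f, IsDiffOp k (D f)

/-! ## Star products -/

/-- A star product on the Poisson manifold `(M, P)`: a `ℂ⟦λ⟧`-bilinear associative product on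
`C^∞(M)⟦λ⟧` with `f ⋆ g = ∑ λ^r C_r(f, g)` for `f, g ∈ C^∞(M)`, where the `C_r` are
bidifferential operators, `C_0(f, g) = f g` and `C_1(f, g) - C_1(g, f) = i {f, g}`. -/
structure StarProduct {n : ℕ} {M : Type u} [TopologicalSpace M]
    [ChartedSpace (EuclideanSpace ℝ (Fin n)) M] (P : PoissonStructure n M) where
  mul : (SmoothFun n M)⟦X⟧ →ₗ[ℂ⟦X⟧] (SmoothFun n M)⟦X⟧ →ₗ[ℂ⟦X⟧] (SmoothFun n M)⟦X⟧
  mul_assoc' : ∀ f g h, mul (mul f g) h = mul f (mul g h)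
  coef : ℕ → SmoothFun n M →ₗ[ℂ] SmoothFun n M →ₗ[ℂ] SmoothFun n M
  mul_C_C : ∀ f g : SmoothFun n M,
    mul (PowerSeries.C f) (PowerSeries.C g) = PowerSeries.mk fun r => coef r f g
  bidiff : ∀ r, IsBidiffOp (coef r)
  coef_zero : ∀ f g, coef 0 f g = f * g
  coef_one : ∀ f g, coef 1 f g - coef 1 g f = Complex.I • P.bracket f g

/-- Formal power series over a commutative `*`-ring form a `*`-ring, with the coefficientwise
involution (the formal parameter is self-adjoint). -/
noncomputable instance PowerSeries.instStarRingCoeff {R : Type*} [CommRing R] [StarRing R] :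
    StarRing R⟦X⟧ where
  star f := PowerSeries.map (starRingEnd R) f
  star_involutive f := by
    ext k
    simp
  star_mul f g := by
    rw [map_mul, mul_comm]
  star_add f g := map_add _ f g

theorem PowerSeries.coeff_star {R : Type*} [CommRing R] [StarRing R] (k : ℕ) (f : R⟦X⟧) :
    PowerSeries.coeff k (star f) = star (PowerSeries.coeff k f) := by
  change PowerSeries.coeff k (PowerSeries.map (starRingEnd R) f) = _
  simp [starRingEnd_apply]

/-- A star product is Hermitian if `conj (f ⋆ g) = conj g ⋆ conj f`. -/
structure HermitianStarProduct {n : ℕ} {M : Type u} [TopologicalSpace M]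
    [ChartedSpace (EuclideanSpace ℝ (Fin n)) M] (P : PoissonStructure n M)
    extends StarProduct P where
  hermitian : ∀ f g, star (mul f g) = mul (star g) (star f)

/-! ### The unit of a star product -/

section Unit

variable {A : Type u} [CommRing A] [Algebra ℂ A]

theorem PowerSeries.formal_smul_def (c : ℂ⟦X⟧) (f : A⟦X⟧) :
    c • f = PowerSeries.map (algebraMap ℂ A) c * f := rfl

theorem PowerSeries.X_smul_formal (f : A⟦X⟧) :
    (PowerSeries.X : ℂ⟦X⟧) • f = PowerSeries.X * f := by
  rw [PowerSeries.formal_smul_def, PowerSeries.map_X]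

theorem PowerSeries.eq_C_add_X_smul (f : A⟦X⟧) :
    ∃ g : A⟦X⟧, f = PowerSeries.C (PowerSeries.constantCoeff f) + (PowerSeries.X : ℂ⟦X⟧) • g := by
  refine ⟨PowerSeries.mk fun k => PowerSeries.coeff (k + 1) f, ?_⟩
  rw [PowerSeries.X_smul_formal]
  ext k
  cases k with
  | zero => simp
  | succ k => simp [PowerSeries.coeff_succ_X_mul]

/-- A `ℂ⟦λ⟧`-linear endomorphism that is the identity modulo `λ` is bijective. -/
theorem PowerSeries.bijective_of_id_mod (L : A⟦X⟧ →ₗ[ℂ⟦X⟧] A⟦X⟧)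
    (hL : ∀ f, PowerSeries.constantCoeff (L f) = PowerSeries.constantCoeff f) :
    Function.Bijective L := by
  have hX : ∀ f g : A⟦X⟧, (PowerSeries.X : ℂ⟦X⟧) • f = (PowerSeries.X : ℂ⟦X⟧) • g → f = g := by
    intro f g h
    rw [PowerSeries.X_smul_formal, PowerSeries.X_smul_formal] at h
    ext k
    have := congrArg (PowerSeries.coeff (k + 1)) h
    simpa [PowerSeries.coeff_succ_X_mul] using this
  constructor
  · rw [injective_iff_map_eq_zero]
    have key : ∀ k : ℕ, ∀ f, L f = 0 → PowerSeries.coeff k f = 0 := by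
      intro k
      induction k with
      | zero =>
        intro f hf
        have := hL f
        rw [hf] at this
        simpa using this.symm
      | succ k ih =>
        intro f hf
        obtain ⟨g, hg⟩ := PowerSeries.eq_C_add_X_smul f
        have h0 : PowerSeries.constantCoeff f = 0 := by
          rw [← hL f, hf, map_zero]
        rw [h0, map_zero, zero_add] at hg
        have h1 : L g = 0 := by
          apply hX
          rw [← map_smul, ← hg, hf, smul_zero]
        rw [hg, PowerSeries.X_smul_formal, PowerSeries.coeff_succ_X_mul]
        exact ih g h1
    intro f hf
    ext k
    simpa using key k f hf
  · have hN : ∀ f, ∃ g, f - L f = (PowerSeries.X : ℂ⟦X⟧) • g := by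
      intro f
      obtain ⟨g, hg⟩ := PowerSeries.eq_C_add_X_smul (f - L f)
      refine ⟨g, ?_⟩
      rw [map_sub, hL f, sub_self, map_zero, zero_add] at hg
      exact hg
    choose N hN using hN
    let Z : A⟦X⟧ → A⟦X⟧ := fun f =>
      PowerSeries.mk fun k => ∑ j ∈ Finset.range (k + 1), PowerSeries.coeff (k - j) (N^[j] f)
    have hZ : ∀ f, Z f = f + (PowerSeries.X : ℂ⟦X⟧) • Z (N f) := by
      intro f
      rw [PowerSeries.X_smul_formal]
      ext k
      cases k with
      | zero => simp [Z]
      | succ k =>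
        simp only [Z, map_add, PowerSeries.coeff_succ_X_mul, PowerSeries.coeff_mk]
        rw [Finset.sum_range_succ' _ (k + 1), add_comm]
        simp [Function.iterate_succ_apply]
    have hW : ∀ f, L (Z f) - f = (PowerSeries.X : ℂ⟦X⟧) • (L (Z (N f)) - N f) := by
      intro f
      have h1 : L (Z f) = L f + (PowerSeries.X : ℂ⟦X⟧) • L (Z (N f)) := by
        conv_lhs => rw [hZ f]
        rw [map_add, map_smul]
      rw [h1, smul_sub, ← hN f]
      abel
    have hW0 : ∀ k : ℕ, ∀ f, PowerSeries.coeff k (L (Z f) - f) = 0 := by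
      intro k
      induction k with
      | zero =>
        intro f
        rw [hW f, PowerSeries.X_smul_formal]
        simp
      | succ k ih =>
        intro f
        rw [hW f, PowerSeries.X_smul_formal, PowerSeries.coeff_succ_X_mul]
        exact ih (N f)
    intro f
    refine ⟨Z f, sub_eq_zero.mp ?_⟩
    ext k
    simpa using hW0 k f

end Unit

namespace StarProduct

variable {n : ℕ} {M : Type u} [TopologicalSpace M]
  [ChartedSpace (EuclideanSpace ℝ (Fin n)) M] {P : PoissonStructure n M}

theorem constantCoeff_mul (S : StarProduct P) (f g : (SmoothFun n M)⟦X⟧) :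
    PowerSeries.constantCoeff (S.mul f g) =
      PowerSeries.constantCoeff f * PowerSeries.constantCoeff g := by
  obtain ⟨f', hf⟩ := PowerSeries.eq_C_add_X_smul f
  obtain ⟨g', hg⟩ := PowerSeries.eq_C_add_X_smul g
  have hX : ∀ h : (SmoothFun n M)⟦X⟧,
      PowerSeries.constantCoeff ((PowerSeries.X : ℂ⟦X⟧) • h) = 0 := by
    intro h
    rw [PowerSeries.X_smul_formal]
    simp
  have h1 : ∀ h, PowerSeries.constantCoeff (S.mul ((PowerSeries.X : ℂ⟦X⟧) • f') h) = 0 := by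
    intro h
    rw [LinearMap.map_smul₂, hX]
  have h2 : ∀ h, PowerSeries.constantCoeff (S.mul h ((PowerSeries.X : ℂ⟦X⟧) • g')) = 0 := by
    intro h
    rw [LinearMap.map_smul, hX]
  conv_lhs => rw [hf, hg]
  rw [map_add, LinearMap.map_add₂, map_add, map_add, h1, h2, S.mul_C_C, add_zero, add_zero,
    ← PowerSeries.coeff_zero_eq_constantCoeff_apply (PowerSeries.mk _), PowerSeries.coeff_mk,
    S.coef_zero]

/-- Every star product has a two-sided unit (which need not be the constant function `1`). -/
theorem exists_unit (S : StarProduct P) :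
    ∃ e, ∀ f, S.mul e f = f ∧ S.mul f e = f := by
  obtain ⟨hli, hls⟩ := PowerSeries.bijective_of_id_mod (S.mul 1) (fun f => by
    rw [S.constantCoeff_mul]; simp)
  obtain ⟨hri, hrs⟩ := PowerSeries.bijective_of_id_mod (S.mul.flip 1) (fun f => by
    rw [LinearMap.flip_apply, S.constantCoeff_mul]; simp)
  obtain ⟨e, he⟩ := hls 1
  obtain ⟨e', he'⟩ := hrs 1
  rw [LinearMap.flip_apply] at he'
  have h1 : ∀ f, S.mul e f = f := fun f => hli (by rw [← S.mul_assoc', he])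
  have h2 : ∀ f, S.mul f e' = f := fun f => hri (by
    rw [LinearMap.flip_apply, LinearMap.flip_apply, S.mul_assoc', he'])
  have h3 : e = e' := by rw [← h2 e, h1 e']
  exact ⟨e, fun f => ⟨h1 f, by rw [h3]; exact h2 f⟩⟩

/-- The underlying space `C^∞(M)⟦λ⟧` of the star product algebra `(C^∞(M)⟦λ⟧, ⋆)`. -/
def Alg (_S : StarProduct P) : Type u := (SmoothFun n M)⟦X⟧

noncomputable instance (S : StarProduct P) : AddCommGroup S.Alg :=
  inferInstanceAs (AddCommGroup (SmoothFun n M)⟦X⟧)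

noncomputable instance (S : StarProduct P) : Module ℂ⟦X⟧ S.Alg :=
  inferInstanceAs (Module ℂ⟦X⟧ (SmoothFun n M)⟦X⟧)

/-- The ring `(C^∞(M)⟦λ⟧, ⋆)`. -/
noncomputable instance (S : StarProduct P) : Ring S.Alg where
  __ := (inferInstance : AddCommGroup S.Alg)
  mul f g := S.mul f g
  one := S.exists_unit.choose
  mul_assoc := S.mul_assoc'
  one_mul f := (S.exists_unit.choose_spec f).1
  mul_one f := (S.exists_unit.choose_spec f).2
  zero_mul f := LinearMap.map_zero₂ S.mul f
  mul_zero f := (S.mul f).map_zero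
  left_distrib f g h := (S.mul f).map_add g h
  right_distrib f g h := LinearMap.map_add₂ S.mul f g h

noncomputable instance (S : StarProduct P) : Algebra ℂ⟦X⟧ S.Alg :=
  Algebra.ofModule (fun c f g => LinearMap.map_smul₂ S.mul c f g)
    (fun c f g => (S.mul f).map_smul c g)

end StarProduct

namespace HermitianStarProduct

variable {n : ℕ} {M : Type u} [TopologicalSpace M]
  [ChartedSpace (EuclideanSpace ℝ (Fin n)) M] {P : PoissonStructure n M}

/-- The star product algebra `(C^∞(M)⟦λ⟧, ⋆)` of a Hermitian star product. -/
abbrev Alg (S : HermitianStarProduct P) : Type u := S.toStarProduct.Alg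

/-- Complex conjugation of functions is an involution of the algebra `(C^∞(M)⟦λ⟧, ⋆)`. -/
noncomputable instance (S : HermitianStarProduct P) : StarRing S.Alg where
  star f := star (R := (SmoothFun n M)⟦X⟧) f
  star_involutive f := star_star (R := (SmoothFun n M)⟦X⟧) f
  star_mul := S.hermitian
  star_add f g := star_add (R := (SmoothFun n M)⟦X⟧) f g

instance (S : HermitianStarProduct P) : StarModule ℂ⟦X⟧ S.Alg where
  star_smul c f := by
    have h : ∀ (c : ℂ⟦X⟧) (f : (SmoothFun n M)⟦X⟧), star (c • f) = star c • star f := by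
      intro c f
      rw [PowerSeries.formal_smul_def, PowerSeries.formal_smul_def, star_mul, mul_comm]
      congr 1
    exact h c f

end HermitianStarProduct

/-! ## Positivity over `ℂ⟦λ⟧ = ℝ⟦λ⟧(i)` -/

/-- The ordering of the ordered ring `ℝ⟦λ⟧`: a formal power series is positive if its lowest
nonvanishing coefficient exists and is positive. -/
def RealFormalPos (a : ℝ⟦X⟧) : Prop :=
  ∃ k : ℕ, (∀ j < k, PowerSeries.coeff j a = 0) ∧ 0 < PowerSeries.coeff k a

/-- `0 < z` for `z ∈ ℂ⟦λ⟧`: `z` lies in `ℝ⟦λ⟧` and is positive there. -/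
def FormalPos (z : ℂ⟦X⟧) : Prop :=
  ∃ a : ℝ⟦X⟧, RealFormalPos a ∧ z = PowerSeries.map Complex.ofRealHom a

/-- `0 ≤ z` for `z ∈ ℂ⟦λ⟧`. -/
def FormalNonneg (z : ℂ⟦X⟧) : Prop := z = 0 ∨ FormalPos z

/-- A linear functional `τ` is positive if `τ(a* a) ≥ 0` for all `a`. -/
def IsPositiveFunctional {A : Type u} [Ring A] [Algebra ℂ⟦X⟧ A] [StarRing A]
    (τ : A →ₗ[ℂ⟦X⟧] ℂ⟦X⟧) : Prop :=
  ∀ a : A, FormalNonneg (τ (star a * a))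

/-- An element `a` is positive if `τ(a) ≥ 0` for all positive linear functionals `τ`. -/
def IsPositiveElement {A : Type u} [Ring A] [Algebra ℂ⟦X⟧ A] [StarRing A] (a : A) : Prop :=
  ∀ τ : A →ₗ[ℂ⟦X⟧] ℂ⟦X⟧, IsPositiveFunctional τ → FormalNonneg (τ a)

/-! ## `*`-representations and strong Morita equivalence -/

/-- A pre-Hilbert space over `ℂ⟦λ⟧`: the inner product is linear in the second argument. -/
structure FormalPreHilbert (H : Type u) [AddCommGroup H] [Module ℂ⟦X⟧ H] where
  inner : H →ₗ⋆[ℂ⟦X⟧] H →ₗ[ℂ⟦X⟧] ℂ⟦X⟧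
  conj_symm : ∀ φ ψ, star (inner ψ φ) = inner φ ψ
  pos_def : ∀ φ, φ ≠ 0 → FormalPos (inner φ φ)

/-- A `*`-representation of the `*`-algebra `A` over `ℂ⟦λ⟧` on a pre-Hilbert space: an algebra
homomorphism to the adjointable endomorphisms with `π(a*)` the adjoint of `π(a)`. -/
structure FormalStarRep (A : Type u) [Ring A] [Algebra ℂ⟦X⟧ A] [StarRing A]
    {H : Type u} [AddCommGroup H] [Module ℂ⟦X⟧ H] (ip : FormalPreHilbert H) where
  toHom : A →ₙₐ[ℂ⟦X⟧] Module.End ℂ⟦X⟧ H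
  adjoint : ∀ a φ ψ, ip.inner φ (toHom a ψ) = ip.inner (toHom (star a) φ) ψ

/-- The structure of a (`*`-)equivalence bimodule on the `(B, A)`-bimodule `E`: full Hermitian
inner products with values in `A` (linear in the second argument) and in `B` (linear in the first
argument), which are compatible, such that the inner product
`⟨x ⊗ φ, y ⊗ ψ⟩ = ⟨φ, π(⟨x, y⟩) ψ⟩` on `E ⊗[A] H` is positive semi-definite for every
`*`-representation `(H, π)` of `A`. -/
structure StrongEquivalenceBimodule (B A : Type u)
    [Ring B] [Algebra ℂ⟦X⟧ B] [StarRing B] [Ring A] [Algebra ℂ⟦X⟧ A] [StarRing A]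
    (E : Type u) [AddCommGroup E] [Module ℂ⟦X⟧ E] [Module B E] [Module Aᵐᵒᵖ E] where
  innerA : E →ₗ⋆[ℂ⟦X⟧] E →ₗ[ℂ⟦X⟧] A
  innerA_conj_symm : ∀ x y, star (innerA y x) = innerA x y
  innerA_smul_right : ∀ x y (a : A), innerA x (op a • y) = innerA x y * a
  innerA_pos : ∀ x, IsPositiveElement (innerA x x)
  innerA_adjoint : ∀ (b : B) x y, innerA (b • x) y = innerA x (star b • y)
  innerB : E →ₗ[ℂ⟦X⟧] E →ₗ⋆[ℂ⟦X⟧] B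
  innerB_conj_symm : ∀ x y, star (innerB y x) = innerB x y
  innerB_smul_left : ∀ (b : B) x y, innerB (b • x) y = b * innerB x y
  innerB_pos : ∀ x, IsPositiveElement (innerB x x)
  innerB_adjoint : ∀ x y (a : A), innerB x (op a • y) = innerB (op (star a) • x) y
  compatible : ∀ x y z, innerB x y • z = op (innerA y z) • x
  fullA : Submodule.span ℂ⟦X⟧ {a : A | ∃ x y, innerA x y = a} = ⊤
  fullB : Submodule.span ℂ⟦X⟧ {b : B | ∃ x y, innerB x y = b} = ⊤
  /- A general element of `E ⊗[A] H` is `∑ i, x i ⊗ φ i`. -/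
  tensor_nonneg : ∀ (H : Type u) [AddCommGroup H] [Module ℂ⟦X⟧ H] (ip : FormalPreHilbert H)
    (π : FormalStarRep A ip) (m : ℕ) (x : Fin m → E) (φ : Fin m → H),
    FormalNonneg (∑ i, ∑ j, ip.inner (φ i) (π.toHom (innerA (x i) (x j)) (φ j)))

/-- Strong Morita equivalence of unital `*`-algebras over `ℂ⟦λ⟧`: existence of an equivalence
bimodule. -/
def StronglyMoritaEquivalent (A B : Type u)
    [Ring A] [Algebra ℂ⟦X⟧ A] [StarRing A] [Ring B] [Algebra ℂ⟦X⟧ B] [StarRing B] : Prop :=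
  ∃ (E : Type u) (_ : AddCommGroup E) (_ : Module ℂ⟦X⟧ E) (_ : Module B E) (_ : Module Aᵐᵒᵖ E)
    (_ : IsScalarTower ℂ⟦X⟧ B E) (_ : IsScalarTower ℂ⟦X⟧ Aᵐᵒᵖ E) (_ : SMulCommClass B Aᵐᵒᵖ E),
    Nonempty (StrongEquivalenceBimodule B A E)

/-! Write `A`, `B` for the two star product algebras; both are λ-adically complete deformations of
the same commutative algebra C^∞(M).

Strong implies ring-theoretic equivalence by the usual Morita argument: fullness writes 1 as a sum
of values of each inner product, and this makes Hom_B(E, -) faithful, full and essentially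
surjective (`StrongEquivalenceBimodule.isMoritaEquivalent`).

Conversely, an equivalence turns `A` into a `B`-progenerator E with End_B(E) = Aᵒᵖ
(`MoritaEquivalence.exists_progenerator`). Three obstacles separate E from a `*`-equivalence
bimodule. (1) E needs a `B`-valued Hermitian form. Matrices 1 + a a* over `B` are invertible, since
this holds pointwise on M and units lift along the deformation. Kaplansky's formula then replaces
the idempotent of a dual basis by a projection, which gives a form and a finite frame
(`HermitianFrame.nonempty`). (2) The adjoint of this form induces an involution † on `A` that may
differ from `*`. Modulo λ, `A` acts on E by multiplication operators, through a homomorphism κ : A →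
C^∞(M) with kernel λA and κ(a†) = conj κ(a). Reality of a function is a spectral property, so also
κ(a*) = conj κ(a), and † = * modulo λ. Then a ↦ (a†)* is an automorphism equal to the identity
modulo λ; its square root τ is an automorphism with τ(a†) = τ(a)* (`exists_intertwiner`), and
twisting the action by τ⁻¹ turns † into `*`. (3) Positivity. Classically E is a line bundle, so t =
∑ Θ(z_k, z_k) over the frame is 1 modulo λ (`cl_sum_form_vec`). Rescaling by t^(-1/2) gives vectors
q_k with ∑ Θ(q_k, q_k) = 1, whence ⟨x, y⟩ = ∑ ⟨q_k, x⟩* ⟨q_k, y⟩. This sum of squares yields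
positivity of ⟨x, x⟩ and the condition on tensor products. -/

/-! ## Adically complete modules -/

/-- An `ℓ`-torsion-free, `ℓ`-adically separated and complete module.  Completeness
is stated through the remainders `s k = ∑ j, ℓ ^ j y (k + j)` of a convergent series. -/
structure FormalComplete {𝕂 : Type*} [CommRing 𝕂] (ℓ : 𝕂) (V : Type*) [AddCommGroup V]
    [Module 𝕂 V] : Prop where
  torsionFree : ∀ v : V, ℓ • v = 0 → v = 0
  separated : ∀ v : V, (∀ k : ℕ, ∃ w : V, v = (ℓ ^ k) • w) → v = 0
  complete : ∀ y : ℕ → V, ∃ s : ℕ → V, ∀ k, s k = y k + ℓ • s (k + 1)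

namespace FormalComplete

variable {𝕂 : Type*} [CommRing 𝕂] {ℓ : 𝕂}

section Module

variable {V : Type*} [AddCommGroup V] [Module 𝕂 V]

theorem smul_cancel (hV : FormalComplete ℓ V) {v w : V} (h : ℓ • v = ℓ • w) : v = w :=
  sub_eq_zero.mp (hV.torsionFree _ (by rw [smul_sub, h, sub_self]))

/-- Iteration gives v = ℓ^k ν^k v for every k. This contraction principle is behind the uniqueness
of square roots and the multiplicativity of τ. -/
theorem eq_zero_of_eq_smul (hV : FormalComplete ℓ V) (ν : V →ₗ[𝕂] V) {v : V}
    (h : v = ℓ • ν v) : v = 0 := by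
  refine hV.separated v fun k => ⟨(ν ^ k) v, ?_⟩
  induction k with
  | zero => simp
  | succ k ih =>
    rw [pow_succ ν, Module.End.mul_apply]
    nth_rw 1 [ih, h]
    rw [map_smul, smul_smul, pow_succ]

theorem eq_zero_of_remainder (hV : FormalComplete ℓ V) {s : ℕ → V}
    (h : ∀ k, s k = ℓ • s (k + 1)) (k : ℕ) : s k = 0 := by
  refine hV.separated _ fun m => ⟨s (k + m), ?_⟩
  induction m with
  | zero => simp
  | succ m ih => rw [ih, h (k + m), smul_smul, pow_succ, add_assoc]

theorem pi {ι : Type*} (hV : FormalComplete ℓ V) : FormalComplete ℓ (ι → V) where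
  torsionFree v h := funext fun i => hV.torsionFree _ (congrFun h i)
  separated v h := funext fun i => hV.separated _ fun k => by
    obtain ⟨w, hw⟩ := h k
    exact ⟨w i, congrFun hw i⟩
  complete y := by
    choose s hs using fun i => hV.complete fun k => y k i
    exact ⟨fun k i => s i k, fun k => funext fun i => hs i k⟩

/-- No condition on `W` is needed: remainders of a series are unique, so remainders chosen pointwise
are automatically linear in the argument. -/
theorem linearMap {W : Type*} [AddCommGroup W] [Module 𝕂 W] (hV : FormalComplete ℓ V) :
    FormalComplete ℓ (W →ₗ[𝕂] V) where
  torsionFree v h := LinearMap.ext fun i => hV.torsionFree _ (LinearMap.congr_fun h i)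
  separated v h := LinearMap.ext fun i => hV.separated _ fun k => by
    obtain ⟨w, hw⟩ := h k
    exact ⟨w i, LinearMap.congr_fun hw i⟩
  complete y := by
    choose s hs using fun i => hV.complete fun k => y k i
    have hadd : ∀ k a b, s (a + b) k = s a k + s b k := by
      intro k a b
      refine sub_eq_zero.mp (hV.eq_zero_of_remainder
        (s := fun k => s (a + b) k - (s a k + s b k)) (fun k => ?_) k)
      simp only [hs (a + b) k, hs a k, hs b k, map_add]
      module
    have hsmul : ∀ k (c : 𝕂) a, s (c • a) k = c • s a k := by
      intro k c a
      refine sub_eq_zero.mp (hV.eq_zero_of_remainder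
        (s := fun k => s (c • a) k - c • s a k) (fun k => ?_) k)
      simp only [hs (c • a) k, hs a k, map_smul]
      module
    exact ⟨fun k => ⟨⟨fun i => s i k, hadd k⟩, hsmul k⟩, fun k => LinearMap.ext fun i => hs i k⟩

end Module

/-! ### Inverses and square roots of elements congruent to 1 -/

section Ring

variable {R : Type*} [Ring R] [Algebra 𝕂 R]

/-- Neumann series: s k is the sum of ℓ^j (-r)^(k+j), and uniqueness of remainders gives s (k+1) =
-r s k = s k (-r). -/
theorem exists_inverse (hR : FormalComplete ℓ R) (r : R) :
    ∃ s, (1 + ℓ • r) * s = 1 ∧ s * (1 + ℓ • r) = 1 := by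
  obtain ⟨s, hs⟩ := hR.complete fun k => (-r) ^ k
  have h1 : ∀ k, s (k + 1) = -r * s k := by
    intro k
    refine sub_eq_zero.mp (hR.eq_zero_of_remainder
      (s := fun k => s (k + 1) - -r * s k) (fun k => ?_) k)
    simp only [hs (k + 1), hs k, mul_add, mul_smul_comm, pow_succ']
    module
  have h2 : ∀ k, s (k + 1) = s k * -r := by
    intro k
    refine sub_eq_zero.mp (hR.eq_zero_of_remainder
      (s := fun k => s (k + 1) - s k * -r) (fun k => ?_) k)
    simp only [hs (k + 1), hs k, add_mul, smul_mul_assoc, pow_succ]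
    module
  have h0 := hs 0
  rw [pow_zero] at h0
  refine ⟨s 0, ?_, ?_⟩
  · rw [h1 0] at h0
    rw [add_mul, one_mul, smul_mul_assoc]
    nth_rw 1 [h0]
    rw [neg_mul]
    module
  · rw [h2 0] at h0
    rw [mul_add, mul_one, mul_smul_comm]
    nth_rw 1 [h0]
    rw [mul_neg]
    module

theorem isUnit_of_mod (hR : FormalComplete ℓ R) {a b r r' : R} (h : a * b = 1 + ℓ • r)
    (h' : b * a = 1 + ℓ • r') : IsUnit a := by
  obtain ⟨s, h1, -⟩ := hR.exists_inverse r
  obtain ⟨s', -, h2⟩ := hR.exists_inverse r'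
  rw [← h, mul_assoc] at h1
  rw [← h', ← mul_assoc] at h2
  have h3 : s' * b = b * s := by
    rw [← mul_one (s' * b), ← h1, ← mul_assoc, h2, one_mul]
  exact ⟨⟨a, b * s, h1, by rw [← h3, h2]⟩, rfl⟩

/-- Modulo ℓ the equation reads 2δ = 0. With c = 1/2 it becomes δ = ℓ ν(δ) for a linear ν. -/
theorem eq_zero_of_anticomm (hR : FormalComplete ℓ R) {c : 𝕂} (hc : c + c = 1) (g h δ : R)
    (e : (1 + ℓ • g) * δ + δ * (1 + ℓ • h) = 0) : δ = 0 := by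
  refine hR.eq_zero_of_eq_smul
    (-(c • (LinearMap.mulLeft 𝕂 g + LinearMap.mulRight 𝕂 h))) ?_
  simp only [add_mul, mul_add, one_mul, mul_one, smul_mul_assoc, mul_smul_comm] at e
  simp only [LinearMap.neg_apply, LinearMap.smul_apply, LinearMap.add_apply,
    LinearMap.mulLeft_apply, LinearMap.mulRight_apply]
  have h1 : δ = (c + c) • δ := by rw [hc, one_smul]
  linear_combination (norm := module) h1 + c • e

/-- Square roots which are the identity modulo `λ` are unique. -/
theorem sqrt_unique (hR : FormalComplete ℓ R) {c : 𝕂} (hc : c + c = 1) {s t a b : R} (hs : s = 1 + ℓ • a)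
    (ht : t = 1 + ℓ • b) (h : s * s = t * t) : s = t := by
  refine sub_eq_zero.mp (hR.eq_zero_of_anticomm hc a b (s - t) ?_)
  rw [← hs, ← ht, mul_sub, sub_mul, h]
  abel

theorem exists_sqrt (hR : FormalComplete ℓ R) {c : 𝕂} (hc : c + c = 1) (r : R) :
    ∃ u, (1 + ℓ • u) * (1 + ℓ • u) = 1 + ℓ • r := by
  -- The equation for u is u = c r - ℓ c u². The first component of p k is the iterate u_k, the
  -- second is d_k with u_{k+1} = u_k + ℓ^k d_k; carrying d_k along avoids division by ℓ^k. Its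
  -- recursion comes from u_{k+1}² - u_k² = u_{k+1}(u_{k+1} - u_k) + (u_{k+1} - u_k)u_k, valid
  -- without commutativity.
  let p : ℕ → R × R := fun k => Nat.rec (0, c • r)
    (fun k q => (q.1 + (ℓ ^ k) • q.2, -(c • ((q.1 + (ℓ ^ k) • q.2) * q.2 + q.2 * q.1)))) k
  have hp1 : ∀ k, (p (k + 1)).1 = (p k).1 + (ℓ ^ k) • (p k).2 := fun k => rfl
  have hp2 : ∀ k, (p (k + 1)).2 = -(c • ((p (k + 1)).1 * (p k).2 + (p k).2 * (p k).1)) :=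
    fun k => rfl
  have hrec : ∀ k, (p (k + 1)).1 = c • r - (ℓ * c) • ((p k).1 * (p k).1) := by
    intro k
    induction k with
    | zero => rw [hp1]; simp [p]
    | succ k ih =>
      rw [hp1 (k + 1), hp2 k]
      nth_rw 1 [ih]
      have h2 : (ℓ ^ k) • (p k).2 = (p (k + 1)).1 - (p k).1 := by rw [hp1]; abel
      have h3 : (ℓ ^ (k + 1)) • -(c • ((p (k + 1)).1 * (p k).2 + (p k).2 * (p k).1)) =
          -((ℓ * c) • ((p (k + 1)).1 * ((ℓ ^ k) • (p k).2) + ((ℓ ^ k) • (p k).2) * (p k).1)) := by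
        rw [mul_smul_comm, smul_mul_assoc]
        module
      rw [h3, h2, mul_sub, sub_mul]
      module
  obtain ⟨s, hs⟩ := hR.complete fun k => (p k).2
  have hu : ∀ k, s 0 = (p k).1 + (ℓ ^ k) • s k := by
    intro k
    induction k with
    | zero => simp [p]
    | succ k ih => rw [ih, hp1, hs k]; module
  refine ⟨s 0, ?_⟩
  have key : s 0 - c • r + (ℓ * c) • (s 0 * s 0) = 0 := by
    refine hR.separated _ fun k => ⟨ℓ • s (k + 1) + (ℓ * c) • (s k * s 0 + (p k).1 * s k), ?_⟩
    have h1 : s 0 * s 0 = (p k).1 * (p k).1 + (ℓ ^ k) • (s k * s 0 + (p k).1 * s k) := by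
      have e1 : (ℓ ^ k) • (s k * s 0) = (s 0 - (p k).1) * s 0 := by
        rw [← smul_mul_assoc]; congr 1; nth_rw 1 [hu k]; abel
      have e2 : (ℓ ^ k) • ((p k).1 * s k) = (p k).1 * (s 0 - (p k).1) := by
        rw [← mul_smul_comm]; congr 1; nth_rw 1 [hu k]; abel
      rw [smul_add, e1, e2, sub_mul, mul_sub]
      abel
    rw [h1]
    nth_rw 1 [hu (k + 1)]
    rw [hrec k]
    module
  simp only [add_mul, mul_add, one_mul, mul_one, smul_mul_assoc, mul_smul_comm]
  have h1 : ∀ v : R, v = (c + c) • v := fun v => by rw [hc, one_smul]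
  have h2 := h1 r
  have h3 := h1 (s 0 * s 0)
  linear_combination (norm := module) (2 * ℓ) • key - ℓ • h2 + (ℓ * ℓ) • h3

end Ring

end FormalComplete

/-! ### Square roots of automorphisms and conjugacy of involutions -/

namespace FormalComplete

variable {𝕂 : Type*} [CommRing 𝕂] {ℓ : 𝕂}

theorem exists_linear_div {V W : Type*} [AddCommGroup V] [Module 𝕂 V] [AddCommGroup W]
    [Module 𝕂 W] (hW : FormalComplete ℓ W) (L : V →ₗ[𝕂] W) (h : ∀ v, ∃ w, L v = ℓ • w) :
    ∃ N : V →ₗ[𝕂] W, L = ℓ • N := by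
  choose N hN using h
  refine ⟨⟨⟨N, fun a b => hW.smul_cancel ?_⟩, fun r a => hW.smul_cancel ?_⟩, LinearMap.ext hN⟩
  · rw [smul_add, ← hN, ← hN, ← hN, map_add]
  · rw [← hN, RingHom.id_apply, smul_comm, ← hN, map_smul]

variable {A : Type*} [Ring A] [Algebra 𝕂 A]

/-- A square root, equal to the identity modulo `ℓ`, of a multiplicative map is multiplicative. -/
theorem sqrt_map_mul (hA : FormalComplete ℓ A) {c : 𝕂} (hc : c + c = 1) {σ τ u : Module.End 𝕂 A}
    (hτ : τ = 1 + ℓ • u) (hsq : τ * τ = σ) (hσ : ∀ a b, σ (a * b) = σ a * σ b) (a b : A) :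
    τ (a * b) = τ a * τ b := by
  -- The defect D(a, b) = τ(ab) - τ(a)τ(b) satisfies D(τa, τb) + τ(D(a, b)) = 0 because τ² is
  -- multiplicative. As τ = 1 + ℓu, expanding and halving gives D = ℓ N(D), so D vanishes.
  let N : (A →ₗ[𝕂] A →ₗ[𝕂] A) →ₗ[𝕂] (A →ₗ[𝕂] A →ₗ[𝕂] A) :=
    { toFun := fun D => -(c • (D.compl₁₂ u LinearMap.id + D.compl₁₂ LinearMap.id u +
        ℓ • D.compl₁₂ u u + D.compr₂ u))
      map_add' := fun D D' => by
        ext a b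
        simp only [LinearMap.neg_apply, LinearMap.smul_apply, LinearMap.add_apply,
          LinearMap.compl₁₂_apply, LinearMap.compr₂_apply, map_add]
        module
      map_smul' := fun r D => by
        ext a b
        simp only [LinearMap.neg_apply, LinearMap.smul_apply, LinearMap.add_apply,
          LinearMap.compl₁₂_apply, LinearMap.compr₂_apply, map_smul, RingHom.id_apply]
        module }
  let D : A →ₗ[𝕂] A →ₗ[𝕂] A :=
    (LinearMap.mul 𝕂 A).compr₂ τ - (LinearMap.mul 𝕂 A).compl₁₂ τ τ
  have hD : ∀ a b, D a b = τ (a * b) - τ a * τ b := fun a b => rfl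
  have hsq' : ∀ a, τ (τ a) = σ a := fun a => by rw [← hsq]; rfl
  have hτ' : ∀ a, τ a = a + ℓ • u a := fun a => by rw [hτ]; rfl
  have e1 : ∀ a b, D (τ a) (τ b) + τ (D a b) = 0 := by
    intro a b
    rw [hD, hD, map_sub, hsq', hsq', hsq', hσ]
    abel
  have e2 : D = ℓ • N D := by
    ext a b
    have h1 := e1 a b
    rw [hτ' (D a b), hτ' a, hτ' b] at h1
    simp only [map_add, map_smul, LinearMap.add_apply, LinearMap.smul_apply] at h1
    have h2 : D a b = (c + c) • D a b := by rw [hc, one_smul]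
    simp only [N, LinearMap.coe_mk, AddHom.coe_mk, LinearMap.neg_apply, LinearMap.smul_apply,
      LinearMap.add_apply, LinearMap.compl₁₂_apply, LinearMap.compr₂_apply, LinearMap.id_apply]
    linear_combination (norm := module) h2 + c • h1
  have e3 := hA.linearMap.linearMap.eq_zero_of_eq_smul N e2
  have := hD a b
  rw [e3] at this
  exact sub_eq_zero.mp this.symm

variable [StarRing 𝕂] [StarRing A] [StarModule 𝕂 A]

/-- The conjugate `a ↦ (L a*)*` of a linear endomorphism. -/
def starConj (L : Module.End 𝕂 A) : Module.End 𝕂 A where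
  toFun a := star (L (star a))
  map_add' a b := by simp
  map_smul' c a := by simp [star_smul]

/-- Two involutions of an algebra which agree modulo `ℓ` are conjugate by an automorphism. -/
theorem exists_intertwiner (hA : FormalComplete ℓ A) {c : 𝕂} (hc : c + c = 1) (hℓ : star ℓ = ℓ)
    (dag : A → A) (dag_add : ∀ a b, dag (a + b) = dag a + dag b)
    (dag_smul : ∀ (r : 𝕂) a, dag (r • a) = star r • dag a)
    (dag_mul : ∀ a b, dag (a * b) = dag b * dag a) (dag_dag : ∀ a, dag (dag a) = a)
    (hmod : ∀ a, ∃ b, dag a = star a + ℓ • b) :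
    ∃ τ : A ≃ₐ[𝕂] A, ∀ a, τ (dag a) = star (τ a) := by
  -- The composite of the two involutions is an algebra automorphism, equal to the identity modulo
  -- ℓ; τ will be its square root.
  let σ : Module.End 𝕂 A :=
    { toFun := fun a => star (dag a)
      map_add' := fun a b => by rw [dag_add, star_add]
      map_smul' := fun r a => by rw [dag_smul, star_smul, star_star]; rfl }
  have hσ : ∀ a, σ a = star (dag a) := fun a => rfl
  have hσmul : ∀ a b, σ (a * b) = σ a * σ b := fun a b => by
    rw [hσ, dag_mul, star_mul]; rfl
  have hdag : ∀ a, dag a = star (σ a) := fun a => by rw [hσ, star_star]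
  obtain ⟨N, hN⟩ := hA.exists_linear_div (σ - 1) (fun a => by
    obtain ⟨b, hb⟩ := hmod a
    refine ⟨star b, ?_⟩
    rw [LinearMap.sub_apply, hσ, hb, star_add, star_smul, hℓ, star_star, Module.End.one_apply]
    abel)
  have hE : FormalComplete ℓ (Module.End 𝕂 A) := hA.linearMap
  obtain ⟨v, hv⟩ := hE.exists_sqrt hc N
  rw [← hN, add_sub_cancel] at hv
  obtain ⟨τi, h1, h2⟩ := hE.exists_inverse v
  set τ : Module.End 𝕂 A := 1 + ℓ • v with hτ
  have hsq : ∀ a, τ (τ a) = σ a := fun a => by rw [← hv]; rfl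
  have hi1 : ∀ a, τ (τi a) = a := fun a => LinearMap.congr_fun h1 a
  have hi2 : ∀ a, τi (τ a) = a := fun a => LinearMap.congr_fun h2 a
  -- Conjugating σ by `star` inverts it, so both sides are square roots of σ⁻¹ congruent to 1, and
  -- such roots are unique.
  have hconj : starConj τ = τi := by
    refine hE.sqrt_unique hc (a := starConj v) (b := -(v * τi)) ?_ ?_ ?_
    · ext a
      simp [starConj, hτ, star_smul, hℓ]
    · have : τi + ℓ • (v * τi) = 1 := by
        rw [← h1, hτ, add_mul, one_mul, smul_mul_assoc]
      rw [← this]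
      module
    · ext a
      have e1 : (starConj τ * starConj τ) a = dag (star a) := by
        simp [starConj, hsq, hσ]
      have e2 : τi (τi (σ (dag (star a)))) = dag (star a) := by rw [← hsq, hi2, hi2]
      rw [e1, ← e2, hσ, dag_dag, star_star]
      rfl
  have hτs : ∀ a, τ (star (τ a)) = star a := by
    intro a
    have := hi1 (star a)
    rw [← hconj] at this
    simpa [starConj] using this
  have hmul := hA.sqrt_map_mul hc hτ hv hσmul
  have hone : τ 1 = 1 := by
    have := hmul 1 (τi 1)
    rw [one_mul, hi1, mul_one] at this
    exact this.symm
  refine ⟨AlgEquiv.ofLinearEquiv (LinearEquiv.ofLinearMap τ τi h1 h2) hone hmul, fun a => ?_⟩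
  change τ (dag a) = star (τ a)
  rw [hdag, ← hsq, hτs]

end FormalComplete

/-! ## Smooth functions -/

namespace SmoothFun

variable {n : ℕ} {M : Type u} [TopologicalSpace M] [ChartedSpace (EuclideanSpace ℝ (Fin n)) M]

/-- Evaluation at a point. -/
noncomputable def evalHom (x : M) : SmoothFun n M →+* ℂ where
  toFun f := f x
  map_one' := rfl
  map_mul' _ _ := rfl
  map_zero' := rfl
  map_add' _ _ := rfl

theorem isUnit_iff (f : SmoothFun n M) : IsUnit f ↔ ∀ x, f x ≠ 0 := by
  constructor
  · intro h x
    exact (h.map (evalHom x)).ne_zero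
  · intro h
    have hs : ContMDiff (𝓡 n) 𝓘(ℝ, ℂ) ∞ (fun x => (f x)⁻¹) := fun x =>
      ContMDiffAt.comp (I' := 𝓘(ℝ, ℂ)) x (contDiffAt_inv ℝ (h x)).contMDiffAt (f.contMDiff x)
    refine IsUnit.of_mul_eq_one ⟨fun x => (f x)⁻¹, hs⟩ ?_
    ext x
    exact mul_inv_cancel₀ (h x)

theorem eq_zero_of_sq (f : SmoothFun n M) (h : f * f = 0) : f = 0 := by
  ext x
  have := congrArg (evalHom x) h
  rw [map_mul, map_zero] at this
  exact mul_self_eq_zero.mp this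

theorem algebraMap_apply (c : ℂ) (x : M) : (algebraMap ℂ (SmoothFun n M) c) x = c := rfl

/-- Reality is expressed by units alone, so that it can be carried along ring homomorphisms not
known to respect the involutions. -/
theorem isSelfAdjoint_iff (f : SmoothFun n M) :
    star f = f ↔ ∀ c : ℂ, star c ≠ c → IsUnit (f - algebraMap ℂ _ c) := by
  constructor
  · intro h c hc
    rw [isUnit_iff]
    intro x hx
    have h1 : f x = c := sub_eq_zero.mp hx
    apply hc
    rw [← h1, ← star_apply, h]
  · intro h
    ext x
    by_contra hx
    exact (isUnit_iff _).mp (h (f x) hx) x (sub_self _)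

-- At each point the matrix is 1 + a a* over ℂ, which is positive definite, so the determinant has
-- no zeros.
open scoped ComplexOrder in
theorem isUnit_one_add_mul_star {k : ℕ} (a : Matrix (Fin k) (Fin k) (SmoothFun n M)) :
    IsUnit (1 + a * star a) := by
  rw [Matrix.isUnit_iff_isUnit_det, isUnit_iff]
  intro x
  have h1 : (1 + a * star a).det x = (1 + (evalHom x).mapMatrix a *
      ((evalHom x).mapMatrix a).conjTranspose).det := by
    change evalHom x (1 + a * star a).det = _
    rw [RingHom.map_det, map_add, map_mul, map_one]
    rfl
  rw [h1]
  exact (Matrix.PosDef.one.add_posSemidef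
    (Matrix.posSemidef_self_mul_conjTranspose _)).det_pos.ne'

end SmoothFun

/-! ## Lifting units along a formal deformation -/

/-- A lift of the inverse is an inverse modulo ℓ on both sides, and the Neumann series corrects it.
-/
theorem FormalComplete.isUnit_of_map {𝕂 : Type*} [CommRing 𝕂] {ℓ : 𝕂} {R R' : Type*} [Ring R]
    [Algebra 𝕂 R] [Ring R'] (hR : FormalComplete ℓ R) (f : R →+* R')
    (hf : Function.Surjective f) (hker : ∀ r, f r = 0 → ∃ s, r = ℓ • s) {a : R}
    (ha : IsUnit (f a)) : IsUnit a := by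
  obtain ⟨b, hb⟩ := hf (↑ha.unit⁻¹ : R')
  obtain ⟨r, hr⟩ := hker (a * b - 1) (by rw [map_sub, map_mul, hb]; simp)
  obtain ⟨r', hr'⟩ := hker (b * a - 1) (by rw [map_sub, map_mul, hb]; simp)
  exact hR.isUnit_of_mod (sub_eq_iff_eq_add'.mp hr) (sub_eq_iff_eq_add'.mp hr')

/-- The `*`-algebra `B` is a formal deformation of the commutative `*`-ring `C`, with classical
limit `cl`. -/
structure IsFormalDeformation {𝕂 : Type*} [CommRing 𝕂] (ℓ : 𝕂) {B C : Type*} [Ring B]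
    [Algebra 𝕂 B] [StarRing B] [CommRing C] [StarRing C] (cl : B →+* C) : Prop where
  complete : FormalComplete ℓ B
  surjective : Function.Surjective cl
  cl_smul : ∀ b, cl (ℓ • b) = 0
  ker : ∀ b, cl b = 0 → ∃ b', b = ℓ • b'
  cl_star : ∀ b, cl (star b) = star (cl b)

namespace IsFormalDeformation

variable {𝕂 : Type*} [CommRing 𝕂] {ℓ : 𝕂} {B C : Type*} [Ring B]
    [Algebra 𝕂 B] [StarRing B] [CommRing C] [StarRing C] {cl : B →+* C}

theorem isUnit (h : IsFormalDeformation ℓ cl) {b : B} (hb : IsUnit (cl b)) : IsUnit b :=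
  h.complete.isUnit_of_map cl h.surjective h.ker hb

theorem isUnit_matrix (h : IsFormalDeformation ℓ cl) {k : ℕ} {a : Matrix (Fin k) (Fin k) B}
    (ha : IsUnit (cl.mapMatrix a)) : IsUnit a := by
  refine FormalComplete.isUnit_of_map (ℓ := ℓ) (R := Matrix (Fin k) (Fin k) B)
    h.complete.pi.pi cl.mapMatrix ?_ ?_ ha
  · intro m
    choose b hb using fun i j => h.surjective (m i j)
    exact ⟨Matrix.of b, Matrix.ext hb⟩
  · intro m hm
    choose b hb using fun i j => h.ker (m i j) (congrFun (congrFun hm i) j)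
    exact ⟨Matrix.of b, Matrix.ext hb⟩

theorem isUnit_one_add_mul_star (h : IsFormalDeformation ℓ cl)
    (hC : ∀ (k : ℕ) (a : Matrix (Fin k) (Fin k) C), IsUnit (1 + a * star a)) (k : ℕ)
    (a : Matrix (Fin k) (Fin k) B) : IsUnit (1 + a * star a) := by
  apply h.isUnit_matrix
  convert hC k (cl.mapMatrix a)
  rw [map_add, map_one, map_mul]
  congr 2
  ext i j
  exact h.cl_star _

end IsFormalDeformation

/-! ## Hermitian frames -/

/-- An idempotent in a `*`-ring is equivalent to a projection, if `1 + a a*` is invertible. -/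
theorem exists_projection_of_idempotent {R : Type*} [Ring R] [StarRing R] {q : R}
    (hq : q * q = q) (hu : IsUnit (1 + (q - star q) * star (q - star q))) :
    ∃ p, star p = p ∧ p * q = q ∧ q * p = p := by
  have hs : star q * star q = star q := by rw [← star_mul, hq]
  obtain ⟨v, hv⟩ := hu
  obtain ⟨g, hg, gh⟩ : ∃ g : R, (1 + (q - star q) * star (q - star q)) * g = 1 ∧
      g * (1 + (q - star q) * star (q - star q)) = 1 := ⟨↑v⁻¹, by rw [← hv]; simp, by rw [← hv]; simp⟩
  -- Kaplansky's construction: h is self-adjoint and commutes with q, and the projection is q q*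
  -- h⁻¹.
  set h := 1 + (q - star q) * star (q - star q) with hh
  have h1 : h = 1 - q - star q + q * star q + star q * q := by
    rw [hh, star_sub, star_star, sub_mul, mul_sub, mul_sub, hq, hs]
    abel
  have hhs : star h = h := by
    rw [hh, star_add, star_mul, star_star, star_one]
  have h2 : h * q = q * star q * q := by
    rw [h1, add_mul, add_mul, sub_mul, sub_mul, one_mul, hq, mul_assoc (star q) q q, hq]
    abel
  have h3 : q * h = q * star q * q := by
    rw [h1, mul_add, mul_add, mul_sub, mul_sub, mul_one, hq, ← mul_assoc q q, hq, mul_assoc]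
    abel
  have hgs : star g = g := by
    have e : star g * h = 1 := by
      rw [← hhs, ← star_mul, hg, star_one]
    rw [← mul_one (star g), ← hg, ← mul_assoc, e, one_mul]
  have hgq : g * q = q * g := by
    rw [← mul_one (g * q), ← hg, ← mul_assoc, mul_assoc g q h, h3, ← h2, ← mul_assoc g h q, gh,
      one_mul]
  have hgq' : g * star q = star q * g := by
    have := congrArg star hgq
    rwa [star_mul, star_mul, hgs, eq_comm] at this
  refine ⟨q * star q * g, ?_, ?_, ?_⟩
  · rw [star_mul, star_mul, star_star, hgs, ← mul_assoc, hgq, mul_assoc, hgq', ← mul_assoc]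
  · rw [mul_assoc _ g q, hgq, ← mul_assoc, ← h3, mul_assoc, hg, mul_one]
  · rw [← mul_assoc, ← mul_assoc, hq]

/-- A Hermitian form `Θ(x, y) = form y x` on a module together with finitely many vectors `z k`
such that `x = ∑ k, Θ(x, z k) z k`. -/
structure HermitianFrame (B E : Type*) [Ring B] [StarRing B] [AddCommGroup E] [Module B E] where
  form : E → E →ₗ[B] B
  form_star : ∀ x y, star (form y x) = form x y
  size : ℕ
  vec : Fin size → E
  frame : ∀ x, ∑ k, form (vec k) x • vec k = x

-- The dual basis identifies E with the row vectors fixed by the idempotent q. With p the projection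
-- equivalent to q, the form is Θ(x, w) = φ(x) p φ(w)*, and p q* = p, p q = q make the old vectors y
-- a frame for it.
open Matrix in
theorem HermitianFrame.nonempty {B E : Type*} [Ring B] [StarRing B] [AddCommGroup E] [Module B E]
    (hB : ∀ (k : ℕ) (a : Matrix (Fin k) (Fin k) B), IsUnit (1 + a * star a)) {k : ℕ}
    (φ : Fin k → E →ₗ[B] B) (y : Fin k → E) (hφ : ∀ x, ∑ i, φ i x • y i = x) :
    Nonempty (HermitianFrame B E) := by
  let q : Matrix (Fin k) (Fin k) B := Matrix.of fun i j => φ j (y i)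
  have hvq : ∀ x, (fun i => φ i x) ᵥ* q = fun i => φ i x := by
    intro x
    ext j
    nth_rw 2 [← hφ x]
    rw [map_sum]
    simp [Matrix.vecMul, dotProduct, q]
  have hq : q * q = q := by
    ext i j
    exact congrFun (hvq (y i)) j
  obtain ⟨p, hps, hpq, hqp⟩ := exists_projection_of_idempotent hq (hB k _)
  have hpq' : p * star q = p := by
    rw [← hps, ← star_mul, hqp]
  have hpc : ∀ i j, star (p i j) = p j i := fun i j => congrFun (congrFun hps j) i
  let Θ : E → E →ₗ[B] B := fun w =>
    { toFun := fun x => ∑ i, ∑ j, φ i x * p i j * star (φ j w)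
      map_add' := fun x x' => by
        simp only [map_add, add_mul, Finset.sum_add_distrib]
      map_smul' := fun b x => by
        simp only [map_smul, smul_eq_mul, Finset.mul_sum, mul_assoc, RingHom.id_apply] }
  have hΘ : ∀ w x, Θ w x = ∑ i, ∑ j, φ i x * p i j * star (φ j w) := fun w x => rfl
  refine ⟨⟨Θ, fun x w => ?_, k, y, fun x => ?_⟩⟩
  · rw [hΘ, hΘ, star_sum, Finset.sum_comm]
    simp only [star_sum, star_mul, star_star, hpc, mul_assoc]
  · have h1 : ∀ m, Θ (y m) x = ∑ i, φ i x * p i m := by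
      intro m
      rw [hΘ]
      refine Finset.sum_congr rfl fun i _ => ?_
      conv_rhs => rw [← hpq', Matrix.mul_apply, Finset.mul_sum]
      simp only [mul_assoc]
      rfl
    -- Since Θ(x, y m) = (φ(x) p)_m, the coordinates of the reconstructed vector are φ(x) p q = φ(x)
    -- q = φ(x).
    have h2 : ∀ j, φ j (∑ m, Θ (y m) x • y m) = φ j x := by
      intro j
      have e := congrFun (hvq x) j
      rw [← hpq, ← Matrix.vecMul_vecMul] at e
      rw [map_sum, ← e]
      simp only [map_smul, h1]
      rfl
    rw [← hφ (∑ m, Θ (y m) x • y m)]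
    simp only [h2, hφ]

set_option linter.unusedSectionVars false

namespace HermitianFrame

/-! ### Riesz representation and adjoints for a Hermitian frame -/

section Form

variable {B E : Type*} [Ring B] [StarRing B] [AddCommGroup E] [Module B E]
  (H : HermitianFrame B E)

theorem form_add_left (y y' x : E) : H.form (y + y') x = H.form y x + H.form y' x := by
  rw [← H.form_star, map_add, star_add, H.form_star, H.form_star]

theorem form_smul_left (b : B) (y x : E) : H.form (b • y) x = H.form y x * star b := by
  rw [← H.form_star, map_smul, smul_eq_mul, star_mul, H.form_star]

theorem form_sum_left {ι : Type*} (s : Finset ι) (y : ι → E) (x : E) :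
    H.form (∑ i ∈ s, y i) x = ∑ i ∈ s, H.form (y i) x := by
  rw [← H.form_star, map_sum, star_sum]
  simp only [H.form_star]

theorem ext_form {y y' : E} (h : ∀ x, H.form y x = H.form y' x) : y = y' := by
  rw [← H.frame y, ← H.frame y']
  refine Finset.sum_congr rfl fun k _ => ?_
  rw [← H.form_star, h, H.form_star]

theorem exists_form_eq (g : E →ₗ[B] B) : ∃ v, ∀ x, g x = H.form v x := by
  refine ⟨∑ k, star (g (H.vec k)) • H.vec k, fun x => ?_⟩
  nth_rw 1 [← H.frame x]
  simp only [map_sum, map_smul, form_sum_left, form_smul_left, star_star, smul_eq_mul]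

/-- The adjoint of a linear endomorphism. -/
def adj (T : Module.End B E) : Module.End B E :=
  ∑ k, (H.form (T (H.vec k))).smulRight (H.vec k)

theorem form_adj (T : Module.End B E) (x y : E) : H.form y (T x) = H.form (H.adj T y) x := by
  simp only [adj, LinearMap.sum_apply, LinearMap.smulRight_apply, form_sum_left, form_smul_left,
    H.form_star]
  nth_rw 1 [← H.frame x]
  simp

end Form

/-! ### The `A`-valued inner product and the involution † on `A` -/

section Action

variable {𝕂 : Type*} [CommRing 𝕂] [StarRing 𝕂] {A B E : Type*}
  [Ring A] [Algebra 𝕂 A] [Ring B] [Algebra 𝕂 B] [StarRing B] [StarModule 𝕂 B]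
  [AddCommGroup E] [Module 𝕂 E] [Module B E] [IsScalarTower 𝕂 B E] [SMulCommClass B 𝕂 E]
  (H : HermitianFrame B E) (ρ : Aᵐᵒᵖ ≃ₐ[𝕂] Module.End B E)

theorem form_smul_right' (c : 𝕂) (y x : E) : H.form y (c • x) = c • H.form y x := by
  rw [← algebraMap_smul B c x, map_smul, algebraMap_smul]

theorem form_smul_left' (c : 𝕂) (y x : E) : H.form (c • y) x = star c • H.form y x := by
  rw [← H.form_star, form_smul_right', star_smul, H.form_star]

theorem act_ext {a a' : A} (h : ∀ x, ρ (op a) x = ρ (op a') x) : a = a' :=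
  MulOpposite.op_injective (ρ.injective (LinearMap.ext h))

theorem act_mul (a a' : A) (x : E) : ρ (op (a * a')) x = ρ (op a') (ρ (op a) x) := by
  rw [MulOpposite.op_mul, map_mul]
  rfl

theorem act_one (x : E) : ρ (op (1 : A)) x = x := by
  rw [MulOpposite.op_one, map_one]
  rfl

theorem act_add (a a' : A) (x : E) : ρ (op (a + a')) x = ρ (op a) x + ρ (op a') x := by
  rw [MulOpposite.op_add, map_add]
  rfl

theorem act_sum {ι : Type*} (s : Finset ι) (a : ι → A) (x : E) :
    ρ (op (∑ i ∈ s, a i)) x = ∑ i ∈ s, ρ (op (a i)) x := by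
  rw [← MulOpposite.opAddEquiv_apply, map_sum, map_sum, LinearMap.sum_apply]

theorem act_smul (c : 𝕂) (a : A) (x : E) : ρ (op (c • a)) x = c • ρ (op a) x := by
  rw [MulOpposite.op_smul, map_smul]
  rfl

/-- The inner product with values in `A ≃ End_B(E)ᵒᵖ`, given by the rank one operators. -/
def ip (y z : E) : A := (ρ.symm ((H.form y).smulRight z)).unop

theorem act_ip (y z x : E) : ρ (op (H.ip ρ y z)) x = H.form y x • z := by
  rw [ip, MulOpposite.op_unop, AlgEquiv.apply_symm_apply]
  rfl

/-- The involution of `A ≃ End_B(E)ᵒᵖ` given by the adjoint. -/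
def dag (a : A) : A := (ρ.symm (H.adj (ρ (op a)))).unop

theorem form_act (a : A) (x y : E) : H.form y (ρ (op a) x) = H.form (ρ (op (H.dag ρ a)) y) x := by
  rw [dag, MulOpposite.op_unop, AlgEquiv.apply_symm_apply, form_adj]

theorem dag_eq_of_form {a a' : A} (h : ∀ x y, H.form y (ρ (op a) x) = H.form (ρ (op a') y) x) :
    H.dag ρ a = a' :=
  act_ext ρ fun y => H.ext_form fun x => by rw [← form_act, h]

theorem dag_add (a a' : A) : H.dag ρ (a + a') = H.dag ρ a + H.dag ρ a' :=
  H.dag_eq_of_form ρ fun x y => by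
    rw [act_add, act_add, form_add_left, map_add, form_act, form_act]

theorem dag_smul (c : 𝕂) (a : A) : H.dag ρ (c • a) = star c • H.dag ρ a :=
  H.dag_eq_of_form ρ fun x y => by
    rw [act_smul, act_smul, form_smul_left', star_star, form_smul_right', form_act]

theorem dag_mul (a a' : A) : H.dag ρ (a * a') = H.dag ρ a' * H.dag ρ a :=
  H.dag_eq_of_form ρ fun x y => by
    rw [act_mul, act_mul, form_act, form_act]

theorem dag_dag (a : A) : H.dag ρ (H.dag ρ a) = a :=
  H.dag_eq_of_form ρ fun x y => by
    rw [← H.form_star, ← form_act, H.form_star]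

theorem form_act' (a : A) (x y : E) : H.form (ρ (op a) y) x = H.form y (ρ (op (H.dag ρ a)) x) := by
  rw [form_act, dag_dag]

theorem dag_ip (y z : E) : H.dag ρ (H.ip ρ y z) = H.ip ρ z y :=
  H.dag_eq_of_form ρ fun x u => by
    rw [act_ip, act_ip, map_smul, form_smul_left, H.form_star, smul_eq_mul]

theorem ip_act (y z : E) (a : A) : H.ip ρ y (ρ (op a) z) = H.ip ρ y z * a :=
  act_ext ρ fun x => by rw [act_ip, act_mul, act_ip, map_smul]

theorem ip_smul_left (b : B) (y z : E) : H.ip ρ (b • y) z = H.ip ρ y (star b • z) :=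
  act_ext ρ fun x => by rw [act_ip, act_ip, form_smul_left, mul_smul]

theorem ip_add_right (y z z' : E) : H.ip ρ y (z + z') = H.ip ρ y z + H.ip ρ y z' :=
  act_ext ρ fun x => by rw [act_add, act_ip, act_ip, act_ip, smul_add]

theorem ip_add_left (y y' z : E) : H.ip ρ (y + y') z = H.ip ρ y z + H.ip ρ y' z :=
  act_ext ρ fun x => by rw [act_add, act_ip, act_ip, act_ip, form_add_left, add_smul]

theorem ip_smul_right' (c : 𝕂) (y z : E) : H.ip ρ y (c • z) = c • H.ip ρ y z :=
  act_ext ρ fun x => by rw [act_smul, act_ip, act_ip, smul_comm]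

theorem ip_smul_left' (c : 𝕂) (y z : E) : H.ip ρ (c • y) z = star c • H.ip ρ y z :=
  act_ext ρ fun x => by rw [act_smul, act_ip, act_ip, form_smul_left', smul_assoc]

theorem ip_sum_right {ι : Type*} (s : Finset ι) (y : E) (z : ι → E) :
    H.ip ρ y (∑ i ∈ s, z i) = ∑ i ∈ s, H.ip ρ y (z i) :=
  act_ext ρ fun x => by simp only [act_sum, act_ip, Finset.smul_sum]

theorem sum_ip : ∑ k, H.ip ρ (H.vec k) (H.vec k) = 1 :=
  act_ext ρ fun x => by simp only [act_sum, act_ip, act_one, H.frame]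

end Action

/-! ### The classical limit of the bimodule -/

section Classical

variable {𝕂 : Type*} [CommRing 𝕂] [StarRing 𝕂] {ℓ : 𝕂} {A B C E : Type*}
  [Ring A] [Algebra 𝕂 A] [StarRing A] [Ring B] [Algebra 𝕂 B] [StarRing B] [StarModule 𝕂 B]
  [CommRing C] [StarRing C]
  [AddCommGroup E] [Module 𝕂 E] [Module B E] [IsScalarTower 𝕂 B E] [SMulCommClass B 𝕂 E]
  (H : HermitianFrame B E) (ρ : Aᵐᵒᵖ ≃ₐ[𝕂] Module.End B E)
  (clA : A →+* C) (clB : B →+* C) {m : ℕ} (w v : Fin m → E)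

theorem cl_eq_of_cl_mul_form (hwv : ∑ j, H.form (v j) (w j) = 1) {f g : C}
    (h : ∀ x y, f * clB (H.form y x) = g * clB (H.form y x)) : f = g := by
  rw [← mul_one f, ← mul_one g, ← map_one clB, ← hwv, map_sum, Finset.mul_sum, Finset.mul_sum]
  simp only [h]

/-- The classical limit of the right action of `A` on `E`, which is by multiplication operators. -/
def kappa (a : A) : C := ∑ j, clB (H.form (v j) (ρ (op a) (w j)))

theorem cl_form_act (hA : IsFormalDeformation ℓ clA) (hB : IsFormalDeformation ℓ clB)
    (hwv : ∑ j, H.form (v j) (w j) = 1) (a : A) (x y : E) :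
    clB (H.form y (ρ (op a) x)) = H.kappa ρ clB w v a * clB (H.form y x) := by
  -- `A` is commutative modulo ℓ. Writing x = ∑ w_j ⟨v_j, x⟩, the factor a moves past ⟨v_j, x⟩ up to
  -- ℓ, so x a = ∑ (w_j a)⟨v_j, x⟩ = ∑ Θ(w_j a, v_j) x modulo ℓ.
  have h1 : ∀ j, ∃ d, H.ip ρ (v j) x * a - a * H.ip ρ (v j) x = ℓ • d := fun j => hA.ker _ (by
    rw [map_sub, map_mul, map_mul, mul_comm, sub_self])
  choose d hd using h1
  have h2 : ρ (op a) x = (∑ j, H.form (v j) (ρ (op a) (w j))) • x +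
      ℓ • ∑ j, ρ (op (d j)) (w j) := by
    have e : ∀ j, H.form (v j) (w j) • ρ (op a) x =
        H.form (v j) (ρ (op a) (w j)) • x + ℓ • ρ (op (d j)) (w j) := by
      intro j
      rw [← act_smul, ← hd j, ← map_smul, ← act_ip (ρ := ρ), ← act_ip (ρ := ρ), ← act_mul,
        ← act_mul, ← act_add, add_sub_cancel]
    rw [Finset.sum_smul, Finset.smul_sum, ← Finset.sum_add_distrib, ← Finset.sum_congr rfl
      fun j _ => e j, ← Finset.sum_smul, hwv, one_smul]
  rw [h2, map_add, map_smul, form_smul_right', map_add, hB.cl_smul, add_zero, smul_eq_mul, map_mul,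
    map_sum]
  rfl

/-- `kappa` as a ring homomorphism. -/
def kappaHom (hA : IsFormalDeformation ℓ clA) (hB : IsFormalDeformation ℓ clB)
    (hwv : ∑ j, H.form (v j) (w j) = 1) : A →+* C where
  toFun := H.kappa ρ clB w v
  map_one' := by
    simp only [kappa, act_one]
    rw [← map_sum, hwv, map_one]
  map_zero' := by
    simp [kappa]
  map_add' a a' := by
    simp only [kappa, act_add, map_add, Finset.sum_add_distrib]
  map_mul' a a' := by
    rw [kappa]
    simp only [act_mul]
    simp only [H.cl_form_act ρ clA clB w v hA hB hwv a', ← Finset.mul_sum]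
    rw [mul_comm]
    rfl

theorem kappa_dag (hA : IsFormalDeformation ℓ clA) (hB : IsFormalDeformation ℓ clB)
    (hwv : ∑ j, H.form (v j) (w j) = 1) (a : A) :
    H.kappa ρ clB w v (H.dag ρ a) = star (H.kappa ρ clB w v a) := by
  refine H.cl_eq_of_cl_mul_form clB w v hwv fun x y => ?_
  rw [← H.cl_form_act ρ clA clB w v hA hB hwv, form_act, dag_dag, ← H.form_star, hB.cl_star,
    H.cl_form_act ρ clA clB w v hA hB hwv, star_mul, mul_comm, ← hB.cl_star, H.form_star]

/-- If κ(a) = 0, the frame coefficients of each z_k a lie in ℓB, and a = ∑ ⟨z_k, z_k a⟩. -/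
theorem exists_eq_smul_of_kappa_eq_zero (hA : IsFormalDeformation ℓ clA)
    (hB : IsFormalDeformation ℓ clB) (hwv : ∑ j, H.form (v j) (w j) = 1) (a : A)
    (ha : H.kappa ρ clB w v a = 0) : ∃ a', a = ℓ • a' := by
  have h1 : ∀ k l, ∃ b, H.form (H.vec l) (ρ (op a) (H.vec k)) = ℓ • b := fun k l => hB.ker _ (by
    rw [H.cl_form_act ρ clA clB w v hA hB hwv, ha, zero_mul])
  choose b hb using h1
  refine ⟨∑ k, H.ip ρ (H.vec k) (∑ l, b k l • H.vec l), ?_⟩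
  rw [← one_mul a, ← H.sum_ip ρ, Finset.sum_mul, Finset.smul_sum]
  refine Finset.sum_congr rfl fun k _ => ?_
  rw [← ip_act, ← ip_smul_right', ← H.frame (ρ (op a) (H.vec k))]
  simp only [hb, Finset.smul_sum, smul_assoc]

/-- Both a† and a* are sent by κ to the conjugate of κ(a). The hypothesis `hstar` covers all κ
agreeing with the classical limit on scalars, since κ is not known to coincide with `clA`. -/
theorem dag_eq_star_add (hA : IsFormalDeformation ℓ clA)
    (hB : IsFormalDeformation ℓ clB) (hwv : ∑ j, H.form (v j) (w j) = 1)
    (hstar : ∀ κ : A →+* C, (∀ c : 𝕂, κ (algebraMap 𝕂 A c) = clB (algebraMap 𝕂 B c)) →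
      ∀ a, κ (star a) = star (κ a)) (a : A) : ∃ a', H.dag ρ a = star a + ℓ • a' := by
  obtain ⟨a', ha'⟩ := H.exists_eq_smul_of_kappa_eq_zero ρ clA clB w v hA hB hwv
    (H.dag ρ a - star a) (by
      change H.kappaHom ρ clA clB w v hA hB hwv _ = 0
      rw [map_sub, hstar, sub_eq_zero]
      · exact H.kappa_dag ρ clA clB w v hA hB hwv a
      · intro c
        change H.kappa ρ clB w v _ = _
        simp only [kappa, Algebra.algebraMap_eq_smul_one, act_smul, act_one, form_smul_right']
        rw [← map_sum, ← Finset.smul_sum, hwv])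
  exact ⟨a', sub_eq_iff_eq_add'.mp ha'⟩

/-- The fibres of the classical limit of `E` are one-dimensional. -/
theorem cl_sum_form_vec (ρ : Aᵐᵒᵖ ≃ₐ[𝕂] Module.End B E) (hA : IsFormalDeformation ℓ clA)
    (hB : IsFormalDeformation ℓ clB) (hwv : ∑ j, H.form (v j) (w j) = 1)
    (hC : ∀ f : C, f * f = 0 → f = 0) : clB (∑ k, H.form (H.vec k) (H.vec k)) = 1 := by
  have h1 : ∀ x y z u, clB (H.form y x) * clB (H.form u z) =
      H.kappa ρ clB w v (H.ip ρ y z) * clB (H.form u x) := by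
    intro x y z u
    rw [← H.cl_form_act ρ clA clB w v hA hB hwv, act_ip, map_smul, smul_eq_mul, map_mul]
  obtain ⟨c, hc⟩ : ∃ c : C, ∀ y z, H.kappa ρ clB w v (H.ip ρ y z) = c * clB (H.form y z) := by
    refine ⟨∑ j, H.kappa ρ clB w v (H.ip ρ (v j) (w j)), fun y z => ?_⟩
    rw [kappa, Finset.sum_mul]
    refine Finset.sum_congr rfl fun j _ => ?_
    rw [act_ip, map_smul, smul_eq_mul, map_mul, mul_comm, h1]
  -- Taking z = x and u = y in `h1` gives F² = c F² for every value F of the classical form. Hence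
  -- (c - 1)F has square zero and vanishes by reducedness; the values F generate 1.
  have hc1 : c = 1 := by
    refine H.cl_eq_of_cl_mul_form clB w v hwv fun x y => ?_
    rw [← sub_eq_zero, ← sub_mul]
    apply hC
    have := h1 x y x y
    rw [hc] at this
    linear_combination (1 - c) * this
  refine H.cl_eq_of_cl_mul_form clB w v hwv fun x y => ?_
  rw [map_sum, Finset.sum_mul, one_mul]
  nth_rw 2 [← H.frame x]
  rw [map_sum, map_sum]
  refine Finset.sum_congr rfl fun k _ => ?_
  rw [map_smul, smul_eq_mul, map_mul, h1 x, hc, hc1, one_mul]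

end Classical

end HermitianFrame

/-! ## Positivity -/

theorem RealFormalPos.add {a b : ℝ⟦X⟧} (ha : RealFormalPos a) (hb : RealFormalPos b) :
    RealFormalPos (a + b) := by
  obtain ⟨k, hk, hk'⟩ := ha
  obtain ⟨l, hl, hl'⟩ := hb
  refine ⟨min k l, fun j hj => ?_, ?_⟩
  · rw [map_add, hk j (by omega), hl j (by omega), add_zero]
  · rw [map_add]
    rcases lt_trichotomy k l with h | h | h
    · rw [min_eq_left h.le, hl k h, add_zero]
      exact hk'
    · subst h
      rw [min_self]
      exact add_pos hk' hl'
    · rw [min_eq_right h.le, hk l h, zero_add]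
      exact hl'

theorem FormalNonneg.add {z w : ℂ⟦X⟧} (hz : FormalNonneg z) (hw : FormalNonneg w) :
    FormalNonneg (z + w) := by
  rcases hz with rfl | ⟨a, ha, rfl⟩
  · rwa [zero_add]
  rcases hw with rfl | ⟨b, hb, rfl⟩
  · rw [add_zero]
    exact Or.inr ⟨a, ha, rfl⟩
  · exact Or.inr ⟨a + b, ha.add hb, (map_add _ _ _).symm⟩

theorem FormalNonneg.sum {ι : Type*} (s : Finset ι) (z : ι → ℂ⟦X⟧)
    (h : ∀ i ∈ s, FormalNonneg (z i)) : FormalNonneg (∑ i ∈ s, z i) :=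
  Finset.sum_induction z FormalNonneg (fun _ _ => FormalNonneg.add) (Or.inl rfl) h

theorem IsPositiveElement.sum_star_mul_self {A : Type u} [Ring A] [Algebra ℂ⟦X⟧ A] [StarRing A]
    {ι : Type*} (s : Finset ι) (a : ι → A) : IsPositiveElement (∑ i ∈ s, star (a i) * a i) := by
  intro τ hτ
  rw [map_sum]
  exact FormalNonneg.sum s _ fun i _ => hτ (a i)

theorem FormalPreHilbert.inner_self_nonneg {H : Type u} [AddCommGroup H] [Module ℂ⟦X⟧ H]
    (ip : FormalPreHilbert H) (φ : H) : FormalNonneg (ip.inner φ φ) := by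
  by_cases h : φ = 0
  · left
    rw [h, map_zero]
  · exact Or.inr (ip.pos_def φ h)

/-- The double sum equals the sum over l of the squared norms of ∑_i π(a_{l i}) φ_i. -/
theorem FormalStarRep.sum_inner_nonneg {A : Type u} [Ring A] [Algebra ℂ⟦X⟧ A] [StarRing A]
    {H : Type u} [AddCommGroup H] [Module ℂ⟦X⟧ H] {ip : FormalPreHilbert H}
    (π : FormalStarRep A ip) {m k : ℕ} (a : Fin k → Fin m → A) (φ : Fin m → H) :
    FormalNonneg (∑ i, ∑ j,
      ip.inner (φ i) (π.toHom (∑ l, star (a l i) * a l j) (φ j))) := by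
  have h : ∑ i, ∑ j, ip.inner (φ i) (π.toHom (∑ l, star (a l i) * a l j) (φ j)) =
      ∑ l, ip.inner (∑ i, π.toHom (a l i) (φ i)) (∑ j, π.toHom (a l j) (φ j)) := by
    simp only [map_sum, map_mul, LinearMap.sum_apply, Module.End.mul_apply, π.adjoint (star _),
      star_star]
    rw [Finset.sum_comm]
    simp only [Finset.sum_comm (s := (Finset.univ : Finset (Fin m)))
      (t := (Finset.univ : Finset (Fin k)))]
  rw [h]
  exact FormalNonneg.sum _ _ fun l _ => ip.inner_self_nonneg _

/-! ## Equivalence bimodules from Hermitian frames -/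

namespace HermitianFrame

section Strong

variable {A B E : Type u} [Ring A] [Algebra ℂ⟦X⟧ A] [StarRing A] [Ring B] [Algebra ℂ⟦X⟧ B]
  [StarRing B] [StarModule ℂ⟦X⟧ B] [AddCommGroup E] [Module ℂ⟦X⟧ E] [Module B E]
  [IsScalarTower ℂ⟦X⟧ B E] [SMulCommClass B ℂ⟦X⟧ E]
  (H : HermitianFrame B E) (ρ : Aᵐᵒᵖ ≃ₐ[ℂ⟦X⟧] Module.End B E)

theorem stronglyMoritaEquivalent_of_dag_eq_star (hdag : ∀ a, H.dag ρ a = star a) {m : ℕ}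
    (q : Fin m → E) (hq : ∑ j, H.form (q j) (q j) = 1) : StronglyMoritaEquivalent A B := by
  have hip : ∀ y z, star (H.ip ρ y z) = H.ip ρ z y := fun y z => by rw [← hdag, dag_ip]
  -- Insert 1 = ∑ Θ(q_j, q_j) before z, and use Θ(q_j, q_j) z = q_j ⟨q_j, z⟩.
  have hsq : ∀ y z, H.ip ρ y z = ∑ j, star (H.ip ρ (q j) y) * H.ip ρ (q j) z := by
    intro y z
    nth_rw 1 [← one_smul B z]
    rw [← hq, Finset.sum_smul, ip_sum_right]
    refine Finset.sum_congr rfl fun j _ => ?_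
    rw [← act_ip (ρ := ρ), ip_act, hip]
  let _ : Module Aᵐᵒᵖ E := Module.compHom E (ρ : Aᵐᵒᵖ →+* Module.End B E)
  have hact : ∀ (a : A) (x : E), op a • x = ρ (op a) x := fun a x => rfl
  refine ⟨E, inferInstance, inferInstance, inferInstance, inferInstance, inferInstance,
    ⟨fun c a x => ?_⟩, ⟨fun b a x => ?_⟩, ⟨?_⟩⟩
  · exact act_smul ρ c a.unop x
  · exact (map_smul (ρ a) b x).symm
  · exact
    { innerA := LinearMap.mk₂'ₛₗ (starRingEnd ℂ⟦X⟧) (RingHom.id ℂ⟦X⟧) (H.ip ρ)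
        (fun y y' z => H.ip_add_left ρ y y' z) (fun c y z => H.ip_smul_left' ρ c y z)
        (fun y z z' => H.ip_add_right ρ y z z') (fun c y z => H.ip_smul_right' ρ c y z)
      innerA_conj_symm := fun x y => hip y x
      innerA_smul_right := fun x y a => H.ip_act ρ x y a
      innerA_pos := fun x => by
        change IsPositiveElement (H.ip ρ x x)
        rw [hsq]
        exact IsPositiveElement.sum_star_mul_self _ _
      innerA_adjoint := fun b x y => H.ip_smul_left ρ b x y
      innerB := LinearMap.mk₂'ₛₗ (RingHom.id ℂ⟦X⟧) (starRingEnd ℂ⟦X⟧) (fun x y => H.form y x)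
        (fun x x' y => map_add _ _ _) (fun c x y => H.form_smul_right' c y x)
        (fun x y y' => H.form_add_left y y' x) (fun c x y => H.form_smul_left' c y x)
      innerB_conj_symm := fun x y => H.form_star y x
      innerB_smul_left := fun b x y => map_smul (H.form y) b x
      innerB_pos := fun x => by
        change IsPositiveElement (H.form x x)
        nth_rw 2 [← H.frame x]
        rw [map_sum]
        simp only [map_smul, smul_eq_mul]
        simp only [← fun k => H.form_star (H.vec k) x]
        simpa using IsPositiveElement.sum_star_mul_self Finset.univ fun k => H.form x (H.vec k)
      innerB_adjoint := fun x y a => by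
        change H.form (ρ (op a) y) x = H.form y (ρ (op (star a)) x)
        rw [form_act', hdag]
      compatible := fun x y z => (H.act_ip ρ y z x).symm
      fullA := by
        rw [eq_top_iff]
        intro a _
        rw [← one_mul a, ← H.sum_ip ρ, Finset.sum_mul]
        refine Submodule.sum_mem _ fun k _ => Submodule.subset_span ?_
        exact ⟨_, _, H.ip_act ρ _ _ a⟩
      fullB := by
        rw [eq_top_iff]
        intro b _
        rw [← mul_one b, ← hq, Finset.mul_sum]
        refine Submodule.sum_mem _ fun k _ => Submodule.subset_span ?_
        exact ⟨b • q k, q k, map_smul (H.form (q k)) b (q k)⟩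
      tensor_nonneg := fun K _ _ ip π m x φ => by
        have := π.sum_inner_nonneg (fun j i => H.ip ρ (q j) (x i)) φ
        simp only [← hsq] at this
        exact this }

end Strong

/-! ### Normalising the frame and twisting the action -/

section Deformation

variable {A B E C : Type u} [Ring A] [Algebra ℂ⟦X⟧ A] [StarRing A] [StarModule ℂ⟦X⟧ A]
  [Ring B] [Algebra ℂ⟦X⟧ B] [StarRing B] [StarModule ℂ⟦X⟧ B] [CommRing C] [StarRing C]
  [AddCommGroup E] [Module ℂ⟦X⟧ E] [Module B E]
  [IsScalarTower ℂ⟦X⟧ B E] [SMulCommClass B ℂ⟦X⟧ E]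

theorem _root_.PowerSeries.exists_half : ∃ h : ℂ⟦X⟧, h + h = 1 := by
  refine ⟨PowerSeries.C (2⁻¹ : ℂ), ?_⟩
  rw [← map_add, ← map_one (PowerSeries.C (R := ℂ))]
  norm_num

theorem _root_.PowerSeries.star_X : star (PowerSeries.X : ℂ⟦X⟧) = PowerSeries.X := by
  ext k
  rw [PowerSeries.coeff_star, PowerSeries.coeff_X]
  split_ifs <;> simp

/-- With t the sum over the frame, take q_k = s z_k for s = t^(-1/2). Uniqueness of the root makes s
self-adjoint, so the new sum is s t s* = 1. -/
theorem exists_strictly_full (H : HermitianFrame B E) {clB : B →+* C}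
    (hB : IsFormalDeformation (PowerSeries.X : ℂ⟦X⟧) clB)
    (h : clB (∑ k, H.form (H.vec k) (H.vec k)) = 1) :
    ∃ q : Fin H.size → E, ∑ k, H.form (q k) (q k) = 1 := by
  obtain ⟨c, hc⟩ := PowerSeries.exists_half
  set t := ∑ k, H.form (H.vec k) (H.vec k) with ht
  have hts : star t = t := by
    rw [ht, star_sum]
    simp only [H.form_star]
  obtain ⟨r, hr⟩ := hB.ker (t - 1) (by rw [map_sub, h, map_one, sub_self])
  rw [sub_eq_iff_eq_add'] at hr
  obtain ⟨v, hv⟩ := hB.complete.exists_sqrt hc r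
  rw [← hr] at hv
  obtain ⟨s, hs1, hs2⟩ := hB.complete.exists_inverse v
  set g := 1 + (PowerSeries.X : ℂ⟦X⟧) • v with hg
  have hgs : star g = g := by
    refine hB.complete.sqrt_unique hc (a := star v) (b := v) ?_ hg ?_
    · rw [hg, star_add, star_one, star_smul, PowerSeries.star_X]
    · rw [← star_mul, hv, hts]
  have hss : g * star s = 1 := by
    rw [← hgs, ← star_mul, hs2, star_one]
  refine ⟨fun k => s • H.vec k, ?_⟩
  simp only [form_smul_left, map_smul, smul_eq_mul, ← mul_assoc]
  rw [← Finset.sum_mul, ← Finset.mul_sum, ← ht, ← hv, ← mul_assoc, hs2, one_mul, hss]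

theorem stronglyMoritaEquivalent {clA : A →+* C} {clB : B →+* C}
    (hA : IsFormalDeformation (PowerSeries.X : ℂ⟦X⟧) clA)
    (hB : IsFormalDeformation (PowerSeries.X : ℂ⟦X⟧) clB)
    (hstar : ∀ κ : A →+* C,
      (∀ c : ℂ⟦X⟧, κ (algebraMap ℂ⟦X⟧ A c) = clB (algebraMap ℂ⟦X⟧ B c)) →
      ∀ a, κ (star a) = star (κ a))
    (hC : ∀ f : C, f * f = 0 → f = 0) (H : HermitianFrame B E)
    (ρ : Aᵐᵒᵖ ≃ₐ[ℂ⟦X⟧] Module.End B E) {m : ℕ} (g : Fin m → E →ₗ[B] B) (w : Fin m → E)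
    (hg : ∑ j, g j (w j) = 1) : StronglyMoritaEquivalent A B := by
  obtain ⟨c, hc⟩ := PowerSeries.exists_half
  choose v hv using fun j => H.exists_form_eq (g j)
  simp only [hv] at hg
  obtain ⟨q, hq⟩ := H.exists_strictly_full hB (H.cl_sum_form_vec clA clB w v ρ hA hB hg hC)
  obtain ⟨τ, hτ⟩ := hA.complete.exists_intertwiner hc PowerSeries.star_X (H.dag ρ) (H.dag_add ρ)
    (H.dag_smul ρ) (H.dag_mul ρ) (H.dag_dag ρ)
    (H.dag_eq_star_add ρ clA clB w v hA hB hg hstar)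
  -- Now a acts as τ⁻¹(a) did, and the adjoint of that is the old action of (τ⁻¹ a)† = τ⁻¹(a*).
  refine H.stronglyMoritaEquivalent_of_dag_eq_star ((AlgEquiv.op τ.symm).trans ρ) (fun a => ?_) q hq
  refine H.dag_eq_of_form _ fun x y => ?_
  change H.form y (ρ (op (τ.symm a)) x) = H.form (ρ (op (τ.symm (star a))) y) x
  rw [form_act]
  congr 4
  apply congrArg op
  rw [AlgEquiv.eq_symm_apply, hτ, AlgEquiv.apply_symm_apply]

end Deformation

end HermitianFrame

/-! ## Star products as formal deformations -/

theorem PowerSeries.coeff_X_pow_smul_formal {A : Type u} [CommRing A] [Algebra ℂ A] (k j : ℕ)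
    (f : A⟦X⟧) : PowerSeries.coeff j ((PowerSeries.X ^ k : ℂ⟦X⟧) • f) =
      if k ≤ j then PowerSeries.coeff (j - k) f else 0 := by
  rw [PowerSeries.formal_smul_def, map_pow, PowerSeries.map_X, PowerSeries.coeff_X_pow_mul']

theorem PowerSeries.constantCoeff_star {R : Type*} [CommRing R] [StarRing R] (f : R⟦X⟧) :
    PowerSeries.constantCoeff (star f) = star (PowerSeries.constantCoeff f) := by
  rw [← PowerSeries.coeff_zero_eq_constantCoeff_apply, PowerSeries.coeff_star,
    PowerSeries.coeff_zero_eq_constantCoeff_apply]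

theorem PowerSeries.formalComplete {A : Type u} [CommRing A] [Algebra ℂ A] :
    FormalComplete (PowerSeries.X : ℂ⟦X⟧) A⟦X⟧ where
  torsionFree f h := by
    ext k
    have := congrArg (PowerSeries.coeff (k + 1)) h
    simpa [PowerSeries.X_smul_formal, PowerSeries.coeff_succ_X_mul] using this
  separated f h := by
    ext k
    obtain ⟨g, hg⟩ := h (k + 1)
    rw [hg, PowerSeries.coeff_X_pow_smul_formal, if_neg (by omega), map_zero]
  complete y := by
    refine ⟨fun k => PowerSeries.mk fun i => ∑ j ∈ Finset.range (i + 1),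
      PowerSeries.coeff (i - j) (y (k + j)), fun k => ?_⟩
    rw [PowerSeries.X_smul_formal]
    ext i
    cases i with
    | zero => simp
    | succ i =>
      rw [map_add, PowerSeries.coeff_succ_X_mul, PowerSeries.coeff_mk, PowerSeries.coeff_mk,
        Finset.sum_range_succ' _ (i + 1), add_comm]
      simp [add_assoc, add_comm 1]

namespace StarProduct

variable {n : ℕ} {M : Type u} [TopologicalSpace M]
  [ChartedSpace (EuclideanSpace ℝ (Fin n)) M] {P : PoissonStructure n M}

theorem constantCoeff_one (S : StarProduct P) :
    PowerSeries.constantCoeff (R := SmoothFun n M) (1 : S.Alg) = 1 := by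
  have h : S.mul (1 : S.Alg) (1 : (SmoothFun n M)⟦X⟧) = 1 := one_mul (M := S.Alg) _
  have h' := S.constantCoeff_mul (1 : S.Alg) (1 : (SmoothFun n M)⟦X⟧)
  rw [h, map_one, mul_one] at h'
  exact h'.symm

/-- The classical limit of a star product algebra. -/
noncomputable def cl (S : StarProduct P) : S.Alg →+* SmoothFun n M where
  toFun f := PowerSeries.constantCoeff (R := SmoothFun n M) f
  map_one' := S.constantCoeff_one
  map_mul' f g := S.constantCoeff_mul f g
  map_zero' := map_zero (PowerSeries.constantCoeff (R := SmoothFun n M))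
  map_add' f g := map_add (PowerSeries.constantCoeff (R := SmoothFun n M)) f g

theorem cl_smul (S : StarProduct P) (c : ℂ⟦X⟧) (f : S.Alg) :
    S.cl (c • f) = algebraMap ℂ _ (PowerSeries.constantCoeff c) * S.cl f := by
  have h : PowerSeries.constantCoeff (PowerSeries.map (algebraMap ℂ (SmoothFun n M)) c) =
      algebraMap ℂ _ (PowerSeries.constantCoeff c) := by
    rw [← PowerSeries.coeff_zero_eq_constantCoeff_apply, PowerSeries.coeff_map,
      PowerSeries.coeff_zero_eq_constantCoeff_apply]
  rw [← h]
  exact map_mul (PowerSeries.constantCoeff (R := SmoothFun n M)) _ _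

theorem cl_algebraMap (S : StarProduct P) (c : ℂ⟦X⟧) :
    S.cl (algebraMap ℂ⟦X⟧ S.Alg c) = algebraMap ℂ _ (PowerSeries.constantCoeff c) := by
  rw [Algebra.algebraMap_eq_smul_one, cl_smul, map_one, mul_one]

end StarProduct

namespace HermitianStarProduct

variable {n : ℕ} {M : Type u} [TopologicalSpace M]
  [ChartedSpace (EuclideanSpace ℝ (Fin n)) M] {P : PoissonStructure n M}

theorem isFormalDeformation (S : HermitianStarProduct P) :
    IsFormalDeformation (PowerSeries.X : ℂ⟦X⟧) S.cl where
  complete := PowerSeries.formalComplete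
  surjective f := ⟨PowerSeries.C f, PowerSeries.constantCoeff_C f⟩
  cl_smul b := by
    rw [StarProduct.cl_smul]
    simp
  ker b hb := by
    obtain ⟨g, hg⟩ := PowerSeries.eq_C_add_X_smul (A := SmoothFun n M) b
    refine ⟨g, hg.trans ?_⟩
    have : PowerSeries.constantCoeff (R := SmoothFun n M) b = 0 := hb
    rw [this, map_zero, zero_add]
    rfl
  cl_star b :=
     PowerSeries.constantCoeff_star (R := SmoothFun n M) b

/-- Unital `ℂ`-linear ring homomorphisms from a star product algebra to the smooth functions
commute with the involutions, since reality is a spectral property. -/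
theorem map_star (S : HermitianStarProduct P) (κ : S.Alg →+* SmoothFun n M)
    (hκ : ∀ c : ℂ⟦X⟧, κ (algebraMap ℂ⟦X⟧ S.Alg c) =
      algebraMap ℂ _ (PowerSeries.constantCoeff c)) (a : S.Alg) : κ (star a) = star (κ a) := by
  have hC : ∀ c : ℂ, κ (algebraMap ℂ⟦X⟧ S.Alg (PowerSeries.C c)) = algebraMap ℂ _ c := by
    intro c
    rw [hκ, PowerSeries.constantCoeff_C]
  -- For self-adjoint a and nonreal c, a - c is a unit because its classical limit is; κ preserves
  -- units, so κ(a) never takes the value c.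
  have hself : ∀ a : S.Alg, star a = a → star (κ a) = κ a := by
    intro a ha
    rw [SmoothFun.isSelfAdjoint_iff]
    intro c hc
    rw [← hC, ← map_sub]
    refine IsUnit.map κ (S.isFormalDeformation.isUnit ?_)
    rw [map_sub, StarProduct.cl_algebraMap, PowerSeries.constantCoeff_C]
    refine (SmoothFun.isSelfAdjoint_iff _).mp ?_ c hc
    rw [← S.isFormalDeformation.cl_star, ha]
  have hsc : ∀ c : ℂ, star (algebraMap ℂ⟦X⟧ S.Alg (PowerSeries.C c)) =
      algebraMap ℂ⟦X⟧ S.Alg (PowerSeries.C (star c)) := by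
    intro c
    rw [Algebra.algebraMap_eq_smul_one, Algebra.algebraMap_eq_smul_one, star_smul, star_one]
    congr 1
    ext k
    rw [PowerSeries.coeff_star, PowerSeries.coeff_C, PowerSeries.coeff_C]
    split_ifs <;> simp
  -- The general case follows from the self-adjoint elements a + a* and i(a - a*).
  have h1 := hself (a + star a) (by rw [star_add, star_star, add_comm])
  have h2 := hself (algebraMap ℂ⟦X⟧ S.Alg (PowerSeries.C Complex.I) * (a - star a)) (by
    rw [star_mul, hsc, star_sub, star_star, Complex.star_def, Complex.conj_I, map_neg, map_neg, mul_neg,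
      sub_mul, mul_sub,
      Algebra.commutes _ a, Algebra.commutes _ (star a)]
    abel)
  rw [map_add, star_add] at h1
  rw [map_mul, hC, map_sub, star_mul', star_sub] at h2
  have h3 : star (algebraMap ℂ (SmoothFun n M) Complex.I) = -algebraMap ℂ _ Complex.I := by
    ext x
    simp [SmoothFun.star_apply, SmoothFun.algebraMap_apply]
  rw [h3] at h2
  ext x
  have e1 := congrArg (SmoothFun.evalHom x) h1
  have e2 := congrArg (SmoothFun.evalHom x) h2
  simp only [map_add, map_mul, map_sub, map_neg] at e1 e2
  have e3 : SmoothFun.evalHom x (algebraMap ℂ (SmoothFun n M) Complex.I) = Complex.I := rfl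
  rw [e3] at e2
  change SmoothFun.evalHom x (κ (star a)) = SmoothFun.evalHom x (star (κ a))
  have e4 : Complex.I * (SmoothFun.evalHom x (star (κ a)) - SmoothFun.evalHom x (star (κ (star a)))
      + SmoothFun.evalHom x (κ a) - SmoothFun.evalHom x (κ (star a))) = 0 := by
    linear_combination -e2
  have e5 := (mul_eq_zero.mp e4).resolve_left Complex.I_ne_zero
  linear_combination (-1 / 2) * e1 - (1 / 2) * e5

end HermitianStarProduct

/-! ## Bimodules from equivalences of module categories -/

section Progenerator

open CategoryTheory
open scoped ModuleCat.Algebra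

/-- A module corresponding to the free module of rank one under a full and faithful functor
is a generator. -/
theorem ModuleCat.exists_sum_eq_one {A B : Type u} [Ring A] [Ring B]
    (F : ModuleCat.{u} A ⥤ ModuleCat.{u} B) [F.Full] [F.Faithful] (V : ModuleCat.{u} A)
    (i : F.obj V ≅ ModuleCat.of B B) :
    ∃ (m : ℕ) (f : Fin m → (V ⟶ ModuleCat.of A A)) (v : Fin m → V),
      ∑ j, (f j).hom (v j) = (1 : A) := by
  -- T is the trace ideal of V. Every element of F(A) is hit by a map from B ≅ F(V), which comes
  -- from a map V → A with image in T; so F kills the projection A → A/T.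
  let T : Submodule A A := Submodule.span A {a | ∃ (f : V ⟶ ModuleCat.of A A) (v : V), f.hom v = a}
  let p : ModuleCat.of A A ⟶ ModuleCat.of A (A ⧸ T) := ModuleCat.ofHom T.mkQ
  have hp : p = 0 := by
    apply F.map_injective
    ext x
    let β : ModuleCat.of B B ⟶ F.obj (ModuleCat.of A A) :=
      ModuleCat.ofHom (LinearMap.toSpanSingleton B _ x)
    let f : V ⟶ ModuleCat.of A A := F.preimage (i.hom ≫ β)
    have h1 : f ≫ p = f ≫ 0 := by
      ext v
      have : f.hom v ∈ T := Submodule.subset_span ⟨f, v, rfl⟩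
      simpa [p] using this
    have h2 := congrArg (fun g => i.inv ≫ F.map g) h1
    simp only [Functor.map_comp, f, Functor.map_preimage, Category.assoc,
      Iso.inv_hom_id_assoc] at h2
    have h3 := congrArg (fun g => g.hom (1 : B)) h2
    simpa [β] using h3
  have h1 : (1 : A) ∈ T := by
    have := congrArg (fun g => g.hom (1 : A)) hp
    simpa [p] using this
  obtain ⟨m, c, g, hg⟩ := Submodule.mem_span_set'.mp h1
  choose f v hfv using fun j => (g j).2
  refine ⟨m, f, fun j => c j • v j, ?_⟩
  rw [← hg]
  refine Finset.sum_congr rfl fun j _ => ?_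
  rw [map_smul, hfv]

/-- E is the image of `A`. The preimage of `B` generates `A`, so the identity of `A` factors through
finitely many copies of it, and applying the functor gives a dual basis of E over `B`. The inverse
functor, which sends E back to `A`, shows that E generates `B`. -/
theorem MoritaEquivalence.exists_progenerator {R : Type*} [CommRing R] {A B : Type u} [Ring A]
    [Algebra R A] [Ring B] [Algebra R B] (e : MoritaEquivalence R A B) :
    ∃ (E : Type u) (_ : AddCommGroup E) (_ : Module R E) (_ : Module B E)
      (_ : IsScalarTower R B E) (_ : SMulCommClass B R E)
      (_ : Aᵐᵒᵖ ≃ₐ[R] Module.End B E) (k : ℕ) (φ : Fin k → E →ₗ[B] B) (y : Fin k → E)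
      (m : ℕ) (g : Fin m → E →ₗ[B] B) (w : Fin m → E),
      (∀ x, ∑ i, φ i x • y i = x) ∧ ∑ j, g j (w j) = 1 := by
  let F := e.eqv.functor
  let E : ModuleCat.{u} B := F.obj (ModuleCat.of A A)
  obtain ⟨k, f, v, hfv⟩ := ModuleCat.exists_sum_eq_one F (e.eqv.inverse.obj (ModuleCat.of B B))
    (e.eqv.counitIso.app _)
  obtain ⟨m, g, w, hgw⟩ := ModuleCat.exists_sum_eq_one e.eqv.inverse E
    (e.eqv.unitIso.symm.app _)
  have : SMulCommClass B R E := IsScalarTower.to_smulCommClass'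
  let r : Aᵐᵒᵖ → (ModuleCat.of A A ⟶ ModuleCat.of A A) := fun a =>
    ModuleCat.ofHom (LinearMap.toSpanSingleton A A a.unop)
  have hr : Function.Bijective r := by
    constructor
    · intro a b h
      have := congrArg (fun g => g.hom (1 : A)) h
      simpa [r] using this
    · intro h
      refine ⟨op (h.hom (1 : A)), ?_⟩
      ext
      simp [r]
  let ρl : Aᵐᵒᵖ →ₗ[R] Module.End B E :=
    { toFun := fun a => (F.map (r a)).hom
      map_add' := fun a b => by
        rw [← ModuleCat.hom_add, ← F.map_add]
        congr 2
        ext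
        simp [r]
      map_smul' := fun c a => by
        refine Eq.trans (congrArg (fun h => (F.map h).hom) ?_)
          (congrArg ModuleCat.Hom.hom (Functor.map_smul e.eqv.functor c (r a)))
        ext
        change (1 : A) • (c • a.unop) = algebraMap R A c • ((1 : A) • a.unop)
        rw [one_smul, one_smul, Algebra.smul_def, smul_eq_mul] }
  let ρ : Aᵐᵒᵖ →ₐ[R] Module.End B E := AlgHom.ofLinearMap ρl
    (by
      have h : r 1 = 𝟙 _ := by
        ext
        simp [r]
      change (F.map (r 1)).hom = _
      rw [h, F.map_id]
      rfl)
    (fun a b => by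
      have h : r (a * b) = r b ≫ r a := by
        ext
        simp [r]
      change (F.map (r (a * b))).hom = _
      rw [h, F.map_comp]
      rfl)
  have hρ : Function.Bijective ρ := by
    constructor
    · intro a b h
      exact hr.1 (F.map_injective (ModuleCat.hom_ext h))
    · intro T
      obtain ⟨a, ha⟩ := hr.2 (F.preimage (ModuleCat.ofHom T))
      refine ⟨a, ?_⟩
      change (F.map (r a)).hom = T
      rw [ha, F.map_preimage]
      rfl
  let i := e.eqv.counitIso.app (ModuleCat.of B B)
  let vh : Fin k → (ModuleCat.of A A ⟶ e.eqv.inverse.obj (ModuleCat.of B B)) := fun j =>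
    ModuleCat.ofHom (LinearMap.toSpanSingleton A _ (v j))
  have hid : ∑ j, vh j ≫ f j = 𝟙 (ModuleCat.of A A) := by
    ext
    simp [vh, ModuleCat.hom_sum, hfv]
  refine ⟨E, inferInstance, inferInstance, inferInstance, inferInstance, inferInstance,
    AlgEquiv.ofBijective ρ hρ, k, fun j => (F.map (vh j) ≫ i.hom).hom,
    fun j => (i.inv ≫ F.map (f j)).hom (1 : B), m, fun j => (g j).hom, w, fun x => ?_, hgw⟩
  have h1 := congrArg (fun g => (F.map g).hom x) hid
  simp only [F.map_sum, F.map_id, F.map_comp, ModuleCat.hom_sum, LinearMap.sum_apply] at h1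
  refine Eq.trans (Finset.sum_congr rfl fun j _ => ?_) h1
  rw [← map_smul, smul_eq_mul, mul_one]
  simp

/-! ## Module equivalences from bimodules -/

namespace StrongEquivalenceBimodule

open CategoryTheory
open scoped ModuleCat.Algebra

variable {A B E : Type u} [Ring A] [Algebra ℂ⟦X⟧ A] [StarRing A] [Ring B] [Algebra ℂ⟦X⟧ B]
  [StarRing B] [AddCommGroup E] [Module ℂ⟦X⟧ E] [Module B E] [Module Aᵐᵒᵖ E]
  [SMulCommClass B Aᵐᵒᵖ E]

/-- The left `A`-module of `B`-linear maps out of a `(B, A)`-bimodule. -/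
@[reducible]
def homModule (N : Type u) [AddCommGroup N] [Module B N] : Module A (E →ₗ[B] N) where
  smul a f :=
    { toFun := fun x => f (op a • x)
      map_add' := fun x y => by rw [smul_add, map_add]
      map_smul' := fun b x => by rw [← smul_comm, map_smul, RingHom.id_apply] }
  one_smul f := LinearMap.ext fun x => congrArg f (one_smul _ x)
  mul_smul a a' f := LinearMap.ext fun x => congrArg f (mul_smul (op a') (op a) x)
  smul_zero a := rfl
  smul_add a f g := rfl
  add_smul a a' f := LinearMap.ext fun x =>
    (congrArg f (add_smul (op a) (op a') x)).trans (map_add f _ _)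
  zero_smul f := LinearMap.ext fun x =>
    (congrArg f (zero_smul Aᵐᵒᵖ x)).trans (map_zero f)

attribute [local instance] homModule

theorem homModule_smul_apply {N : Type u} [AddCommGroup N] [Module B N] (a : A) (f : E →ₗ[B] N)
    (x : E) : (a • f) x = f (op a • x) := rfl

variable (A B E) in
/-- The functor `N ↦ Hom_B(E, N)`. -/
def homFunctor : ModuleCat.{u} B ⥤ ModuleCat.{u} A where
  obj N := ModuleCat.of A (E →ₗ[B] N)
  map f := ModuleCat.ofHom
    { toFun := fun g => f.hom ∘ₗ g
      map_add' := fun g h => LinearMap.comp_add _ _ _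
      map_smul' := fun a g => rfl }

instance [IsScalarTower ℂ⟦X⟧ B E] [IsScalarTower ℂ⟦X⟧ Aᵐᵒᵖ E] :
    (homFunctor A B E).Linear ℂ⟦X⟧ where
  map_smul {N N'} f c := by
    refine ModuleCat.hom_ext (LinearMap.ext fun (g : E →ₗ[B] N) => LinearMap.ext fun (x : E) => ?_)
    change algebraMap ℂ⟦X⟧ B c • f.hom (g x) = f.hom (g (op (algebraMap ℂ⟦X⟧ A c) • x))
    rw [← map_smul, ← map_smul, algebraMap_smul, Algebra.algebraMap_eq_smul_one,
      MulOpposite.op_smul, smul_assoc, MulOpposite.op_one, one_smul]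

/-- The conjugate-dual construction of a `B`-module from an `A`-module `N`: additive maps
`f : E → N` with `f (x a*) = a f(x)`. -/
def conjHom (A E : Type u) [Ring A] [StarRing A] [AddCommGroup E] [Module Aᵐᵒᵖ E]
    (N : Type u) [AddCommGroup N] [Module A N] : AddSubgroup (E →+ N) where
  carrier := {f | ∀ (a : A) (x : E), f (op (star a) • x) = a • f x}
  add_mem' {f g} hf hg a x := by
    rw [AddMonoidHom.add_apply, AddMonoidHom.add_apply, hf, hg, smul_add]
  zero_mem' a x := by simp
  neg_mem' {f} hf a x := by
    rw [AddMonoidHom.neg_apply, AddMonoidHom.neg_apply, hf, smul_neg]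

instance conjHomModule (N : Type u) [AddCommGroup N] [Module A N] :
    Module B (conjHom A E N) where
  smul b f := ⟨(f : E →+ N).comp (DistribSMul.toAddMonoidHom E (star b)), fun a x => by
    change (f : E →+ N) (star b • op (star a) • x) = a • (f : E →+ N) (star b • x)
    rw [smul_comm, f.2]⟩
  one_smul f := Subtype.ext <| AddMonoidHom.ext fun x => by
    change (f : E →+ N) (star (1 : B) • x) = _
    rw [star_one, one_smul]
  mul_smul b b' f := Subtype.ext <| AddMonoidHom.ext fun x => by
    change (f : E →+ N) (star (b * b') • x) = (f : E →+ N) (star b' • star b • x)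
    rw [star_mul, mul_smul]
  smul_zero b := rfl
  smul_add b f g := rfl
  add_smul b b' f := Subtype.ext <| AddMonoidHom.ext fun x => by
    change (f : E →+ N) (star (b + b') • x) = (f : E →+ N) (star b • x) + (f : E →+ N) (star b' • x)
    rw [star_add, add_smul, map_add]
  zero_smul f := Subtype.ext <| AddMonoidHom.ext fun x => by
    change (f : E →+ N) (star (0 : B) • x) = 0
    rw [star_zero, zero_smul, map_zero]

theorem conjHom_smul_apply {N : Type u} [AddCommGroup N] [Module A N] (b : B)
    (f : conjHom A E N) (x : E) : (b • f : conjHom A E N).1 x = f.1 (star b • x) := rfl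

variable (σ : StrongEquivalenceBimodule B A E)

theorem exists_sum_innerB : ∃ (m : ℕ) (x y : Fin m → E), ∑ i, σ.innerB (x i) (y i) = 1 := by
  have h : (1 : B) ∈ Submodule.span ℂ⟦X⟧ {b : B | ∃ x y, σ.innerB x y = b} := by
    rw [σ.fullB]
    trivial
  obtain ⟨m, c, g, hg⟩ := Submodule.mem_span_set'.mp h
  choose x y hxy using fun i => (g i).2
  exact ⟨m, fun i => c i • x i, y, by simp only [map_smul, LinearMap.smul_apply, hxy, hg]⟩

theorem exists_sum_innerA : ∃ (m : ℕ) (x y : Fin m → E), ∑ i, σ.innerA (x i) (y i) = 1 := by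
  have h : (1 : A) ∈ Submodule.span ℂ⟦X⟧ {a : A | ∃ x y, σ.innerA x y = a} := by
    rw [σ.fullA]
    trivial
  obtain ⟨m, c, g, hg⟩ := Submodule.mem_span_set'.mp h
  choose x y hxy using fun i => (g i).2
  exact ⟨m, x, fun i => c i • y i, by simp only [map_smul, hxy, hg]⟩

/-- The `B`-linear map `x ↦ Θ(x, y) n`. -/
noncomputable def toModule {N : Type u} [AddCommGroup N] [Module B N] (y : E) (n : N) : E →ₗ[B] N where
  toFun x := σ.innerB x y • n
  map_add' x x' := by rw [map_add, LinearMap.add_apply, add_smul]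
  map_smul' b x := by rw [σ.innerB_smul_left, mul_smul, RingHom.id_apply]

/-- This is compatibility, Θ(z, y) x = z ⟨y, x⟩, pushed through the `B`-linear map g. -/
theorem toModule_apply_self {N : Type u} [AddCommGroup N] [Module B N] (y x : E) (g : E →ₗ[B] N) :
    σ.toModule y (g x) = σ.innerA y x • g :=
  LinearMap.ext fun z => by
    change σ.innerB z y • g x = g (op (σ.innerA y x) • z)
    rw [← map_smul, σ.compatible]

theorem homFunctor_faithful (σ : StrongEquivalenceBimodule B A E) : (homFunctor A B E).Faithful where
  map_injective {N N' f f'} h := by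
    obtain ⟨m, x, y, hxy⟩ := σ.exists_sum_innerB
    ext n
    have h1 : ∀ x y, f.hom (σ.innerB x y • n) = f'.hom (σ.innerB x y • n) := fun x y =>
      LinearMap.congr_fun (LinearMap.congr_fun (congrArg ModuleCat.Hom.hom h) (σ.toModule y n)) x
    rw [← one_smul B n, ← hxy, Finset.sum_smul, map_sum, map_sum]
    exact Finset.sum_congr rfl fun i _ => h1 _ _

theorem homFunctor_full (σ : StrongEquivalenceBimodule B A E) : (homFunctor A B E).Full where
  map_surjective {N N'} t := by
    obtain ⟨m, x, y, hxy⟩ := σ.exists_sum_innerB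
    let T : (E →ₗ[B] N) →ₗ[A] (E →ₗ[B] N') := t.hom
    -- Suggested by n = ∑ Θ(x_i, y_i) n, which writes n as a sum of values of maps E → N. The
    -- `A`-linearity of T then gives f(g z) = (T g) z.
    let f : N → N' := fun n => ∑ i, T (σ.toModule (y i) n) (x i)
    have hfg : ∀ (g : E →ₗ[B] N) z, f (g z) = T g z := by
      intro g z
      simp only [f, toModule_apply_self, map_smul, homModule_smul_apply]
      rw [← map_sum]
      simp only [← σ.compatible]
      rw [← Finset.sum_smul, hxy, one_smul]
    have hadd : ∀ n n', f (n + n') = f n + f n' := by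
      intro n n'
      have h : ∀ y, σ.toModule y (n + n') = σ.toModule y n + σ.toModule y n' := fun y =>
        LinearMap.ext fun x => smul_add (σ.innerB x y) n n'
      simp only [f, h, map_add, LinearMap.add_apply, Finset.sum_add_distrib]
    have hsum : ∀ n : N, n = ∑ i, σ.toModule (y i) n (x i) := by
      intro n
      change n = ∑ i, σ.innerB (x i) (y i) • n
      rw [← Finset.sum_smul, hxy, one_smul]
    let fa : N →+ N' := AddMonoidHom.mk' f hadd
    have hsmul : ∀ (b : B) n, f (b • n) = b • f n := by
      intro b n
      change fa (b • n) = b • fa n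
      rw [hsum n, Finset.smul_sum, map_sum, map_sum, Finset.smul_sum]
      refine Finset.sum_congr rfl fun i _ => ?_
      change f (b • σ.toModule (y i) n (x i)) = b • f (σ.toModule (y i) n (x i))
      rw [← map_smul, hfg, hfg, map_smul]
    refine ⟨ModuleCat.ofHom ⟨⟨f, hadd⟩, hsmul⟩, ?_⟩
    exact ModuleCat.hom_ext (LinearMap.ext fun (g : E →ₗ[B] N) => LinearMap.ext fun z => hfg g z)

theorem homFunctor_essSurj (σ : StrongEquivalenceBimodule B A E) : (homFunctor A B E).EssSurj where
  mem_essImage N := by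
    obtain ⟨m, v, w, hvw⟩ := σ.exists_sum_innerA
    -- W plays the role of E ⊗_A N, with x ⊗ n represented by the map y ↦ ⟨y, x⟩ n.
    let W : ModuleCat.{u} B := ModuleCat.of B (conjHom A E N)
    let k : N → E → conjHom A E N := fun n x =>
      ⟨AddMonoidHom.mk' (fun y => σ.innerA y x • n) (fun y y' => by
          rw [map_add, LinearMap.add_apply, add_smul]), fun a y => by
        change σ.innerA (op (star a) • y) x • n = a • σ.innerA y x • n
        rw [← σ.innerA_conj_symm, σ.innerA_smul_right, star_mul, star_star, σ.innerA_conj_symm,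
          mul_smul]⟩
    have hk : ∀ n x y, (k n x).1 y = σ.innerA y x • n := fun n x y => rfl
    let L : N →ₗ[A] (E →ₗ[B] W) :=
      { toFun := fun n =>
          { toFun := k n
            map_add' := fun x x' => Subtype.ext <| AddMonoidHom.ext fun y => by
              change σ.innerA y (x + x') • n = σ.innerA y x • n + σ.innerA y x' • n
              rw [map_add, add_smul]
            map_smul' := fun b x => Subtype.ext <| AddMonoidHom.ext fun y => by
              change σ.innerA y (b • x) • n = σ.innerA (star b • y) x • n
              rw [σ.innerA_adjoint, star_star] }
        map_add' := fun n n' => LinearMap.ext fun x => Subtype.ext <| AddMonoidHom.ext fun y =>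
          smul_add (σ.innerA y x) n n'
        map_smul' := fun a n => LinearMap.ext fun x => Subtype.ext <| AddMonoidHom.ext fun y => by
          change σ.innerA y x • a • n = σ.innerA y (op a • x) • n
          rw [σ.innerA_smul_right, mul_smul] }
    have hL : ∀ n x y, (L n x : conjHom A E N).1 y = σ.innerA y x • n := fun n x y => rfl
    have hbij : Function.Bijective L := by
      constructor
      · rw [injective_iff_map_eq_zero]
        intro n hn
        have h1 : ∀ x y, σ.innerA y x • n = 0 := by
          intro x y
          rw [← hL, hn]
          rfl
        rw [← one_smul A n, ← hvw, Finset.sum_smul]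
        exact Finset.sum_eq_zero fun i _ => h1 _ _
      · intro f
        -- If f is the image of n, then f(w_i)(v_i) = ⟨v_i, w_i⟩ n, and these sum to n.
        refine ⟨∑ i, (f (w i) : conjHom A E N).1 (v i), ?_⟩
        refine LinearMap.ext fun x => Subtype.ext <| AddMonoidHom.ext fun y => ?_
        -- ⟨y, x⟩ f(w_i)(v_i) = f(w_i)(v_i ⟨x, y⟩) = f(w_i)(Θ(v_i, x) y) = (Θ(x, v_i) f(w_i))(y),
        -- and Θ(x, v_i) w_i = x ⟨v_i, w_i⟩.
        have h1 : ∀ i, σ.innerA y x • (f (w i) : conjHom A E N).1 (v i) =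
            (f (op (σ.innerA (v i) (w i)) • x) : conjHom A E N).1 y := by
          intro i
          have e1 : (f (op (σ.innerA (v i) (w i)) • x) : conjHom A E N) =
              σ.innerB x (v i) • (f (w i) : conjHom A E N) := by
            rw [← σ.compatible, map_smul]
          rw [← (f (w i) : conjHom A E N).2, e1, conjHom_smul_apply, σ.innerA_conj_symm,
            σ.innerB_conj_symm, σ.compatible]
        rw [hL, Finset.smul_sum]
        simp only [h1]
        have h2 : f x = ∑ i, f (op (σ.innerA (v i) (w i)) • x) := by
          rw [← map_sum, ← Finset.sum_smul, ← Finset.op_sum, hvw, MulOpposite.op_one, one_smul]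
        have h3 := congrArg (fun g : conjHom A E N => g.1 y) h2
        refine Eq.trans ?_ h3.symm
        change _ = ((∑ i, f (op (σ.innerA (v i) (w i)) • x) : conjHom A E N) : E →+ N) y
        rw [AddSubgroup.val_finsetSum, AddMonoidHom.finsetSum_apply]
    exact ⟨W, ⟨(LinearEquiv.ofBijective L hbij).toModuleIso.symm⟩⟩

theorem isMoritaEquivalent (σ : StrongEquivalenceBimodule B A E) [IsScalarTower ℂ⟦X⟧ B E]
    [IsScalarTower ℂ⟦X⟧ Aᵐᵒᵖ E] :
    IsMoritaEquivalent ℂ⟦X⟧ A B := by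
  have := σ.homFunctor_faithful
  have := σ.homFunctor_full
  have := σ.homFunctor_essSurj
  have : (homFunctor A B E).IsEquivalence := {}
  exact IsMoritaEquivalent.symm _ ⟨⟨(homFunctor A B E).asEquivalence,
    inferInstanceAs ((homFunctor A B E).Linear ℂ⟦X⟧)⟩⟩

end StrongEquivalenceBimodule

/-! ### The main theorem -/

theorem mainTheorem5 {n : ℕ} {M : Type u} [TopologicalSpace M] [T2Space M]
    [SecondCountableTopology M] [ChartedSpace (EuclideanSpace ℝ (Fin n)) M]
    [IsManifold (𝓡 n) ∞ M] (P : PoissonStructure n M) (S S' : HermitianStarProduct P) :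
    StronglyMoritaEquivalent S.Alg S'.Alg ↔ IsMoritaEquivalent ℂ⟦X⟧ S.Alg S'.Alg := by
  constructor
  · rintro ⟨E, _, _, _, _, _, _, _, ⟨σ⟩⟩
    exact σ.isMoritaEquivalent
  · rintro ⟨⟨e⟩⟩
    obtain ⟨E, _, _, _, _, _, ρ, k, φ, y, m, g, w, hφ, hg⟩ := e.exists_progenerator
    obtain ⟨H⟩ := HermitianFrame.nonempty (S'.isFormalDeformation.isUnit_one_add_mul_star
      fun _ => SmoothFun.isUnit_one_add_mul_star) φ y hφ
    refine H.stronglyMoritaEquivalent S.isFormalDeformation S'.isFormalDeformation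
      (fun κ hκ => S.map_star κ fun c => ?_) SmoothFun.eq_zero_of_sq ρ g w hg
    rw [hκ, StarProduct.cl_algebraMap]
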